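/- **Theorem 1.** A *stateful policy* over $n$ actions and $S$ states is a deterministic finite state machine $\pi=(s_0^\pi,f^\pi,g^\pi)$ with an initial state $s_0^\pi\in[S]$, an action function $f^\pi:[S]\to[n]$ and a transition function $g^\pi:[S]\times[0,1]\to[S]$. Against reward functions $r_1,\dots,r_T:[n]\to[0,1]$ fixed in advance by an oblivious adversary, $\pi$ plays $x_t^\pi=f^\pi(s_{t-1}^\pi)$ and moves to $s_t^\pi=g^\pi(s_{t-1}^\pi,r_t(x_t^\pi))$. A (randomized) player chooses $X_t\in[n]$ from its internal randomness and from the rewards $r_1(X_1),\dots,r_{t-1}(X_{t-1})$ that it has observed (bandit feedback). Its expected regret with respect to a reference set $\Pi$ of $k$ stateful policies is $$\mathrm{Regret}_T=\max_{\pi\in\Pi}\sum_{t=1}^T r_t(x_t^\pi)-\mathbf E\Big[\sum_{t=1}^T r_t(X_t)\Big].$$ Consider the following player algorithm, with input $\Pi$ ($k$ policies over $S$ states) and $T\ge 3$. Put $$p=\frac1{kS},\qquad \epsilon=\frac1{\sqrt p}\cdot\frac{\log\log T}{\log^{1/4}T},\qquad d=\Big\lceil\frac1{p^2\epsilon}\log^2\frac1\epsilon\Big\rceil,\qquad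 m=\Big\lceil\frac1p\log\frac1\epsilon\Big\rceil,$$ with $d$ replaced by $2$ if it is smaller than $2$, and $m$ by $0$ if it is negative. The algorithm always holds a policy $\pi_t\in\Pi$ and a state $s_t\in[S]$; the first pair $(\pi_1,s_1)$ is uniformly random. In each round $t$ it plays $f^{\pi_t}(s_t)$, observes the reward $r$, and then either *stays*: $\pi_{t+1}=\pi_t$, $s_{t+1}=g^{\pi_t}(s_t,r)$; or *switches*: $(\pi_{t+1},s_{t+1})$ is a fresh uniformly random element of $\Pi\times[S]$. To decide between the two, it first draws $i_0$ uniformly from $\{1,\dots,\lfloor\log_dT\rfloor\}$ ($i_0=1$ if $d>T$), sets $b=d^{i_0}$, splits the $T$ rounds into consecutive blocks of $b$ rounds (the last one possibly truncated), and in each block runs the following from scratch until the block ends. * Phase I, repeated $m$ times: stay for $b/d$ rounds, record the average of the rewards observed in them, then switch for one round. * Phase II: let $\bar r_1\ge\dots\ge\bar r_m$ be the recorded averages in descending order, $i=1$, $s=0$. Repeat: stay for $b/d$ rounds and let $\bar r$ be the average of the rewards observed in them; if $\bar r<\bar r_i-2\epsilon$, switch for one round and increase $s$ by $1$; if $s\ge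 m$, increase $i$ by $1$ and reset $s=0$. (There are no more switches in the block once $i>m$.) There is an absolute constant $C>0$ such that for all $k,S,n\ge1$, all $T\ge3$, every set $\Pi$ of $k$ stateful policies over $n$ actions and $S$ states, and every oblivious sequence of reward functions, the expected regret of this algorithm satisfies $$\mathrm{Regret}_T\le C\,\sqrt{kS}\cdot\frac{T\log\log T}{\log^{1/4}T}.$$ In particular, for fixed $k$ and $S$ the regret is sublinear in $T$: for every $\eta>0$ there is $T_0$, depending only on $k,S,\eta$, such that $\mathrm{Regret}_T\le\eta T$ for all $T\ge T_0$, all $n$, all such $\Pi$ and all reward functions. -/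

import Mathlib

noncomputable section

namespace StatefulBandit

/-! ### Stateful policies

Rounds `1, 2, …` are indexed by `0, 1, …`. A reward sequence is `r : ℕ → Fin n → unitInterval`, where
`unitInterval` is `[0,1]`, and `r t x` is the reward of action `x` in the round with index `t`. It is fixed before
the game starts (oblivious adversary); in a game of `T` rounds only `r 0, …, r (T - 1)` matter. -/

/-- A deterministic stateful policy over `n` actions and `S` states. -/
structure StatefulPolicy (n S : ℕ) where
  /-- the initial state -/
  init : Fin S
  /-- the action played in a given state -/
  action : Fin S → Fin n
  /-- the new state, from the current state and the observed reward -/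
  next : Fin S → unitInterval → Fin S

variable {n k S : ℕ}

/-- The state of the policy after `t` rounds, had it been followed from the beginning. -/
def StatefulPolicy.state (π : StatefulPolicy n S) (r : ℕ → Fin n → unitInterval) : ℕ → Fin S
  | 0 => π.init
  | t + 1 => π.next (π.state r t) (r t (π.action (π.state r t)))

/-- The total reward in `T` rounds of the policy, had it been followed from the beginning. -/
def StatefulPolicy.totalReward (π : StatefulPolicy n S) (r : ℕ → Fin n → unitInterval) (T : ℕ) : ℝ :=
  ∑ t ∈ Finset.range T, (r t (π.action (π.state r t)) : ℝ)

/-! ### Players under bandit feedback -/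

/-- A (randomized) algorithm of the player: a random seed with a given law, and an action for every
seed and every list of rewards observed so far (most recent reward first). The action depends on
the reward functions only through the rewards of the actions that were actually played. -/
structure Player (n : ℕ) where
  /-- the possible values of the internal randomness -/
  Seed : Type
  /-- there are finitely many of them -/
  [fintypeSeed : Fintype Seed]
  /-- the distribution of the internal randomness -/
  law : PMF Seed
  /-- the next action, given the seed and the rewards observed so far, most recent first -/
  act : Seed → List unitInterval → Fin n

attribute [instance] Player.fintypeSeed

/-- The rewards observed in the first `t` rounds, most recent first, by a player who always plays
the action `f h`, where `h` is the list of rewards observed so far. -/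
def observed (f : List unitInterval → Fin n) (r : ℕ → Fin n → unitInterval) : ℕ → List unitInterval
  | 0 => []
  | t + 1 => r t (f (observed f r t)) :: observed f r t

/-- The expected total reward of the player in `T` rounds. -/
def Player.expectedReward (A : Player n) (r : ℕ → Fin n → unitInterval) (T : ℕ) : ℝ :=
  ∑ ω : A.Seed, (A.law ω).toReal *
    ∑ t ∈ Finset.range T, (r t (A.act ω (observed (A.act ω) r t)) : ℝ)

/-- The expected regret of the player in `T` rounds with respect to `k` reference policies. -/
def Player.regret (A : Player n) (P : Fin k → StatefulPolicy n S) (r : ℕ → Fin n → unitInterval) (T : ℕ) : ℝ :=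
  (⨆ j : Fin k, (P j).totalReward r T) - A.expectedReward r T

/-! ### The controller, which decides in every round whether to stay or to switch

It splits time into consecutive blocks of `b` rounds. In every block it runs the following procedure
with parameters `ε`, `m` and `len`, from scratch, until the block ends.
* Phase I, `m` times: stay for `len` rounds, record the average reward of these rounds, switch once.
* Phase II: let `v₁ ≥ … ≥ vₘ` be the sorted averages of phase I, `i = 1`, `s = 0`, and repeat:
  stay for `len` rounds and let `a` be the average reward of these rounds;
  if `a < vᵢ - 2ε`, switch once and increase `s` by one; if `s ≥ m`, increase `i` by one and
  reset `s = 0`. (Once `i > m`, there is no threshold any more and no switch.)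
Every round, including one with a switch, takes up one round of the game. -/

/-- The memory of the controller. -/
structure Ctrl where
  /-- the number of rounds played in the current block -/
  elapsed : ℕ
  /-- the number of rounds stayed in the current iteration -/
  count : ℕ
  /-- the total reward of these rounds -/
  acc : ℝ
  /-- whether the next round is a switch -/
  pending : Prop
  /-- the averages recorded in phase I -/
  avgs : List ℝ
  /-- the number `i - 1`, where `vᵢ` is the current threshold in phase II -/
  idx : ℕ
  /-- the counter `s` of phase II -/
  fails : ℕ

/-- The memory at the beginning of a block. -/
def Ctrl.start : Ctrl := ⟨0, 0, 0, False, [], 0, 0⟩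

/-- The average `a` is below the `i`-th largest average of phase I by more than `2ε`
(never if there is no `i`-th one); here `idx = i - 1`. -/
def tooLow (ε : ℝ) (avgs : List ℝ) (idx : ℕ) (a : ℝ) : Prop :=
  ∃ v, (avgs.insertionSort (· ≥ ·))[idx]? = some v ∧ a < v - 2 * ε

open Classical in
/-- The bookkeeping at the end of `len` rounds of staying, with average reward `a`. -/
def Ctrl.endIteration (ε : ℝ) (m : ℕ) (c : Ctrl) (a : ℝ) : Ctrl :=
  if c.avgs.length < m then
    -- phase I
    { c with count := 0, acc := 0, pending := True, avgs := c.avgs ++ [a] }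
  else
    -- phase II
    let low : Prop := tooLow ε c.avgs c.idx a
    let s : ℕ := if low then c.fails + 1 else c.fails
    { c with
      count := 0
      acc := 0
      pending := low
      idx := if m ≤ s then c.idx + 1 else c.idx
      fails := if m ≤ s then 0 else s }

open Classical in
/-- The effect on the memory of a round with observed reward `x`, apart from the block structure.
The reward of a round with a switch is ignored. -/
def Ctrl.round (ε : ℝ) (m len : ℕ) (c : Ctrl) (x : ℝ) : Ctrl :=
  if c.pending then
    { c with pending := False }
  else if c.count + 1 < len then
    { c with count := c.count + 1, acc := c.acc + x }
  else
    c.endIteration ε m ((c.acc + x) / len)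

/-- The effect on the memory of a round with observed reward `x`. -/
def Ctrl.step (ε : ℝ) (m len b : ℕ) (c : Ctrl) (x : ℝ) : Ctrl :=
  if c.elapsed + 1 < b then
    { c.round ε m len x with elapsed := c.elapsed + 1 }
  else
    Ctrl.start

/-! ### The parameters -/

/-- `p = 1 / (k S)` -/
def prob (k S : ℕ) : ℝ := 1 / (k * S)

/-- `ε = p^{-1/2} · log log T / log^{1/4} T` -/
def eps (p : ℝ) (T : ℕ) : ℝ :=
  1 / √p * (Real.log (Real.log T) / Real.log T ^ (1 / 4 : ℝ))

/-- `d = (1 / (p² ε)) · log² (1 / ε)`, rounded up to an integer, and at least `2`. -/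
def base (p ε : ℝ) : ℕ := max 2 ⌈1 / (p ^ 2 * ε) * Real.log (1 / ε) ^ 2⌉₊

/-- `m = (1 / p) · log (1 / ε)`, rounded up to an integer. -/
def reps (p ε : ℝ) : ℕ := ⌈1 / p * Real.log (1 / ε)⌉₊

/-- `⌊log_d T⌋`, replaced by `1` if `T < d`. -/
def numScales (d T : ℕ) : ℕ := max 1 (Nat.log d T)

instance (d T : ℕ) : NeZero (numScales d T) := ⟨by unfold numScales; omega⟩

/-! ### The algorithm for competing with stateful policies -/

/-- The configuration of the algorithm after it has observed a list of rewards (most recent first):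
the memory of the controller, and the policy and the state that it currently follows.
The pair `draws t` is the fresh random policy and state that is available at the end of round `t`;
it is used if round `t` is a switch. The pair `draws 0` is the starting point. In round `t` the
current policy is played in the current state, whether the round is a stay or a switch. -/
def config (P : Fin k → StatefulPolicy n S) (ε : ℝ) (m len b : ℕ) (draws : ℕ → Fin k × Fin S) :
    List unitInterval → Ctrl × (Fin k × Fin S)
  | [] => (Ctrl.start, draws 0)
  | x :: h =>
    let c := config P ε m len b draws h
    open Classical in
    (c.1.step ε m len b x,
      if c.1.pending then draws (h.length + 1) else (c.2.1, (P c.2.1).next c.2.2 x))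

/-- The algorithm for competing with the policies `P` in `T` rounds. The seed consists of a scale
`i` in `{1, …, ⌊log_d T⌋}` (indexed from `0`), and of the random policies and states to start from
and to switch to, all uniform and independent. The block size is `b = d ^ i`, and the controller
stays for `b / d` rounds at a time. -/
def algorithm [NeZero k] [NeZero S] (P : Fin k → StatefulPolicy n S) (T : ℕ) : Player n :=
  let p := prob k S
  let ε := eps p T
  let d := base p ε
  { Seed := Fin (numScales d T) × (Fin (T + 1) → Fin k × Fin S)
    law := PMF.uniformOfFintype _
    act := fun ω h =>
      let i := (ω.1 : ℕ) + 1
      let c := config P ε (reps p ε) (d ^ i / d) (d ^ i) (fun t => ω.2 (Fin.ofNat (T + 1) t)) h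
      (P c.2.1).action c.2.2 }

end StatefulBandit

end

/-! Fix a reference policy and let `f` be its own reward sequence, which does not depend on the
player because the adversary is oblivious. At a given scale, call a block of length `b = d * len`
stable if the average of `f` over each of its `d` consecutive windows of length `len` is within `ε /
2` of the block average `μ`.

In a stable block, a fresh pair is the reference policy in its current state with probability `p = 1
/ (k S)`, and then the player earns `f` until the next switch. Iterations are displaced from the
windows only by the switches made so far, at most `m + m²` and so at most `ε / 2 * len`; an
iteration that follows the reference therefore has average within `ε` of `μ`. Except with
probability of order `(1 - p) ^ (m - 1)`, phase I records a threshold within `ε` of `μ`, and phase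
II does not pass all such thresholds, since under a good threshold one hit ends all switching. While
a good threshold remains, the current one is at least `μ - ε`, so a phase II iteration without a
switch earns at least `μ - 3ε` per round; the others number at most `m + m²`.
`add_guarantee_le_blockValue` turns this into an induction over the remaining rounds with the
potential `guarantee`, in which `risk` bounds the probability of losing all good thresholds.

An unstable block may be lost altogether, but its windows have variance: its loss is at most `4d /
ε²` times its contribution to the drop of `energy` from one scale to the next (`sum_variance_eq`,
`block_lower_bound`). Energies lie between `0` and `T` and decrease along the scales, so over `L`
scales the drops total at most `T`, and a random scale pays a fraction `1 / L`
(`regret_le_of_parameters`).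

The parameters balance the losses: `m` makes the failure probability `O(ε)`, `d` makes `m² / d` of
order `ε`, and `ε` is chosen so that `d / (ε² L)` is `O(ε)`. The result is `regret_le_eps`. -/

noncomputable section

namespace StatefulBandit

/-! ### Controlled chains with uniform draws -/

section Chain

variable {X Z : Type*}

/-- The expected total payoff in the next `N` rounds, from round `t` and position `x` on, of the chain that moves in
every round by the map `F` with a fresh uniform draw from `Z`. -/
def chainValue [Fintype Z] (y : ℕ → X → ℝ) (F : ℕ → X → Z → X) : ℕ → ℕ → X → ℝ
  | 0, _, _ => 0
  | N + 1, t, x => y t x + (∑ a, chainValue y F N (t + 1) (F t x a)) / Fintype.card Z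

/-- The positions of the chain when the draws are given. -/
def trajectory (F : ℕ → X → Z → X) (x : X) (u : ℕ → Z) : ℕ → X
  | 0 => x
  | t + 1 => F t (trajectory F x u t) (u t)

lemma trajectory_succ_shift (F : ℕ → X → Z → X) (x : X) (u : ℕ → Z) (t : ℕ) :
    trajectory F x u (t + 1) =
      trajectory (fun s => F (s + 1)) (F 0 x (u 0)) (fun s => u (s + 1)) t := by
  induction t with
  | zero => rfl
  | succ t ih => rw [trajectory, ih]; rfl

lemma chainValue_shift [Fintype Z] (y : ℕ → X → ℝ) (F : ℕ → X → Z → X) (N t : ℕ) (x : X) :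
    chainValue (fun s => y (s + 1)) (fun s => F (s + 1)) N t x = chainValue y F N (t + 1) x := by
  induction N generalizing t x with
  | zero => rfl
  | succ N ih => simp only [chainValue, ih]

/-- The average over all sequences of draws of the total payoff is the value of the chain. -/
lemma sum_trajectory_eq_chainValue [Fintype Z] [Nonempty Z] (N : ℕ) (y : ℕ → X → ℝ) (F : ℕ → X → Z → X) (x : X)
    (e : (Fin N → Z) → ℕ → Z) (he : ∀ w (s : ℕ) (h : s < N), e w s = w ⟨s, h⟩) :
    ∑ w : Fin N → Z, ∑ t ∈ Finset.range N, y t (trajectory F x (e w) t) =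
      (Fintype.card Z : ℝ) ^ N * chainValue y F N 0 x := by
  have hZ : (Fintype.card Z : ℝ) ≠ 0 := by exact_mod_cast Fintype.card_ne_zero
  -- The induction hypothesis is applied to the chain shifted by one round. Beyond the first `N`
  -- places the extension `e` is arbitrary, so the wrap-around of `Fin.ofNat` in the seed is
  -- harmless.
  induction N generalizing y F x with
  | zero => simp [chainValue]
  | succ N ih =>
    rw [← (Fin.consEquiv fun _ => Z).sum_comp, Fintype.sum_prod_type]
    have key : ∀ a : Z, ∑ w : Fin N → Z, ∑ t ∈ Finset.range (N + 1),
        y t (trajectory F x (e (Fin.consEquiv (fun _ => Z) (a, w))) t) =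
        (Fintype.card Z : ℝ) ^ N * (y 0 x + chainValue y F N 1 (F 0 x a)) := by
      intro a
      have := ih (fun s => y (s + 1)) (fun s => F (s + 1)) (F 0 x a)
        (fun w s => e (Fin.consEquiv (fun _ => Z) (a, w)) (s + 1)) (by
          intro w s h
          rw [he _ _ (by omega)]
          exact Fin.cons_succ (α := fun _ => Z) a w ⟨s, h⟩)
      rw [chainValue_shift] at this
      rw [mul_add, ← this]
      have h0 : ∀ w : Fin N → Z, e (Fin.consEquiv (fun _ => Z) (a, w)) 0 = a := by
        intro w
        rw [he _ _ (by omega)]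
        exact Fin.cons_zero (α := fun _ => Z) a w
      simp only [Finset.sum_range_succ', trajectory_succ_shift, h0, Finset.sum_add_distrib]
      simp [trajectory, add_comm]
    rw [Finset.sum_congr rfl fun a _ => key a, ← Finset.mul_sum, Finset.sum_add_distrib, chainValue]
    simp only [Finset.sum_const, Finset.card_univ, nsmul_eq_mul, pow_succ, zero_add]
    field_simp

end Chain

/-! ### The algorithm as a chain -/

variable {n k S : ℕ}

/-- The reward in round `t` of a player that follows the pair `x.2`. -/
def payoff (P : Fin k → StatefulPolicy n S) (r : ℕ → Fin n → unitInterval) (t : ℕ)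
    (x : Ctrl × (Fin k × Fin S)) : ℝ :=
  (r t ((P x.2.1).action x.2.2) : ℝ)

open Classical in
/-- The new configuration after round `t`, where `a` is the fresh pair available at the end of the round. -/
def advance (P : Fin k → StatefulPolicy n S) (r : ℕ → Fin n → unitInterval) (ε : ℝ) (m len b : ℕ) (t : ℕ)
    (x : Ctrl × (Fin k × Fin S)) (a : Fin k × Fin S) : Ctrl × (Fin k × Fin S) :=
  (x.1.step ε m len b (payoff P r t x),
    if x.1.pending then a else (x.2.1, (P x.2.1).next x.2.2 (r t ((P x.2.1).action x.2.2))))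

lemma length_observed (f : List unitInterval → Fin n) (r : ℕ → Fin n → unitInterval) (t : ℕ) :
    (observed f r t).length = t := by
  induction t with
  | zero => rfl
  | succ t ih => simp [observed, ih]

/-- The rewards being fixed in advance, the recursion over histories becomes one over time. The
length of the history is the round index, so each round has its own draw; draw `0` is the starting
pair, hence the shift in `u (s + 1)`. -/
lemma config_observed (P : Fin k → StatefulPolicy n S) (r : ℕ → Fin n → unitInterval) (ε : ℝ) (m len b : ℕ)
    (u : ℕ → Fin k × Fin S) (f : List unitInterval → Fin n)
    (hf : ∀ h, f h = (P (config P ε m len b u h).2.1).action (config P ε m len b u h).2.2) (t : ℕ) :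
    config P ε m len b u (observed f r t) =
      trajectory (advance P r ε m len b) (Ctrl.start, u 0) (fun s => u (s + 1)) t := by
  induction t with
  | zero => rfl
  | succ t ih =>
    rw [trajectory, ← ih]
    simp only [observed, config, advance, payoff, length_observed, hf]

/-- The expected reward in `T` rounds when the block size is `b`, from a given initial pair on. -/
abbrev blockValue (P : Fin k → StatefulPolicy n S) (r : ℕ → Fin n → unitInterval) (ε : ℝ) (m len b : ℕ) :
    ℕ → ℕ → Ctrl × (Fin k × Fin S) → ℝ :=
  chainValue (payoff P r) (advance P r ε m len b)

/-- The expected reward of the algorithm is at least the average over the scales of any lower bounds on the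
values at these scales. -/
lemma le_expectedReward_algorithm [NeZero k] [NeZero S] (P : Fin k → StatefulPolicy n S)
    (r : ℕ → Fin n → unitInterval) (T : ℕ) (g : ℕ → ℝ)
    (hg : ∀ i < numScales (base (prob k S) (eps (prob k S) T)) T, ∀ z,
      g i ≤ blockValue P r (eps (prob k S) T) (reps (prob k S) (eps (prob k S) T))
        (base (prob k S) (eps (prob k S) T) ^ (i + 1) / base (prob k S) (eps (prob k S) T))
        (base (prob k S) (eps (prob k S) T) ^ (i + 1)) T 0 (Ctrl.start, z)) :
    (∑ i ∈ Finset.range (numScales (base (prob k S) (eps (prob k S) T)) T), g i) /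
      numScales (base (prob k S) (eps (prob k S) T)) T ≤ (algorithm P T).expectedReward r T := by
  set ε := eps (prob k S) T with hε
  set d := base (prob k S) ε with hd
  set L := numScales d T with hL
  set m := reps (prob k S) ε with hm
  have hLpos : (0 : ℝ) < L := by exact_mod_cast Nat.pos_of_ne_zero (NeZero.ne L)
  have hZ : (0 : ℝ) < Fintype.card (Fin k × Fin S) := by exact_mod_cast Fintype.card_pos
  have hinner : ∀ i : Fin L, (Fintype.card (Fin k × Fin S) : ℝ) ^ (T + 1) * g i ≤
      ∑ w : Fin (T + 1) → Fin k × Fin S, ∑ t ∈ Finset.range T,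
        (r t ((algorithm P T).act (i, w) (observed ((algorithm P T).act (i, w)) r t)) : ℝ) := by
    intro i
    have h1 : ∀ w : Fin (T + 1) → Fin k × Fin S, ∀ t,
        (r t ((algorithm P T).act (i, w) (observed ((algorithm P T).act (i, w)) r t)) : ℝ) =
        payoff P r t (trajectory (advance P r ε m (d ^ ((i : ℕ) + 1) / d) (d ^ ((i : ℕ) + 1)))
          (Ctrl.start, w 0) (fun s => w (Fin.ofNat (T + 1) (s + 1))) t) := by
      intro w t
      have := config_observed P r ε m (d ^ ((i : ℕ) + 1) / d) (d ^ ((i : ℕ) + 1))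
        (fun t => w (Fin.ofNat (T + 1) t)) ((algorithm P T).act (i, w)) (fun h => rfl) t
      have h0 : w (Fin.ofNat (T + 1) 0) = w 0 := rfl
      simp only [h0] at this
      rw [← this]
      rfl
    simp only [h1]
    -- Draw `0` only fixes the starting pair; the other `T` draws drive the chain. Since `hg` holds
    -- for every starting pair, the randomness of draw `0` is not exploited.
    rw [← (Fin.consEquiv fun _ => Fin k × Fin S).sum_comp, Fintype.sum_prod_type]
    have h2 : ∀ a : Fin k × Fin S, ∑ w : Fin T → Fin k × Fin S, ∑ t ∈ Finset.range T,
        payoff P r t (trajectory (advance P r ε m (d ^ ((i : ℕ) + 1) / d) (d ^ ((i : ℕ) + 1)))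
          (Ctrl.start, Fin.consEquiv (fun _ => Fin k × Fin S) (a, w) 0)
          (fun s => Fin.consEquiv (fun _ => Fin k × Fin S) (a, w) (Fin.ofNat (T + 1) (s + 1))) t) =
        (Fintype.card (Fin k × Fin S) : ℝ) ^ T *
          blockValue P r ε m (d ^ ((i : ℕ) + 1) / d) (d ^ ((i : ℕ) + 1)) T 0 (Ctrl.start, a) := by
      intro a
      refine sum_trajectory_eq_chainValue T (payoff P r)
        (advance P r ε m (d ^ ((i : ℕ) + 1) / d) (d ^ ((i : ℕ) + 1))) (Ctrl.start, a)
        (fun w s => Fin.consEquiv (fun _ => Fin k × Fin S) (a, w) (Fin.ofNat (T + 1) (s + 1))) ?_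
      intro w s h
      have : Fin.ofNat (T + 1) (s + 1) = Fin.succ ⟨s, h⟩ := by
        ext
        simp [Fin.ofNat, Nat.mod_eq_of_lt (show s + 1 < T + 1 by omega)]
      rw [this]
      exact Fin.cons_succ (α := fun _ => Fin k × Fin S) a w ⟨s, h⟩
    simp only [h2]
    rw [← Finset.mul_sum, pow_succ, mul_assoc]
    refine mul_le_mul_of_nonneg_left ?_ (by positivity)
    calc (Fintype.card (Fin k × Fin S) : ℝ) * g i = ∑ _z : Fin k × Fin S, g i := by simp
      _ ≤ _ := Finset.sum_le_sum fun z _ => hg i i.2 z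
  have hlaw : ∀ ω : (algorithm P T).Seed, ((algorithm P T).law ω).toReal =
      1 / (L * (Fintype.card (Fin k × Fin S) : ℝ) ^ (T + 1)) := by
    intro ω
    have : (algorithm P T).law ω =
        (Fintype.card (Fin L × (Fin (T + 1) → Fin k × Fin S)) : ENNReal)⁻¹ :=
      PMF.uniformOfFintype_apply (α := Fin L × (Fin (T + 1) → Fin k × Fin S)) ω
    rw [this, ENNReal.toReal_inv, ENNReal.toReal_natCast, Fintype.card_prod, Fintype.card_fun]
    simp
  unfold Player.expectedReward
  simp only [hlaw]
  rw [← Finset.mul_sum]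
  have : ∑ ω : (algorithm P T).Seed, ∑ t ∈ Finset.range T,
        (r t ((algorithm P T).act ω (observed ((algorithm P T).act ω) r t)) : ℝ) =
      ∑ i : Fin L, ∑ w : Fin (T + 1) → Fin k × Fin S, ∑ t ∈ Finset.range T,
        (r t ((algorithm P T).act (i, w) (observed ((algorithm P T).act (i, w)) r t)) : ℝ) :=
    Fintype.sum_prod_type (α₁ := Fin L) (α₂ := Fin (T + 1) → Fin k × Fin S) _
  rw [this]
  have hsum := Finset.sum_le_sum fun i (_ : i ∈ Finset.univ) => hinner i
  rw [← Finset.mul_sum, Fin.sum_univ_eq_sum_range (fun i => g i) L] at hsum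
  rw [one_div_mul_eq_div, div_le_div_iff₀ hLpos (by positivity)]
  nlinarith

/-! ### The risk of losing all good thresholds -/

/-- The `i`-th threshold (from `0`) exists and is within `ε` of `μ`. -/
def Ctrl.GoodAt (μ ε : ℝ) (c : Ctrl) (i : ℕ) : Prop :=
  ∃ v, (c.avgs.insertionSort (· ≥ ·))[i]? = some v ∧ |v - μ| ≤ ε

lemma Ctrl.exists_goodAt_iff (μ ε : ℝ) (c : Ctrl) :
    (∃ i, c.GoodAt μ ε i) ↔ ∃ v ∈ c.avgs, |v - μ| ≤ ε := by
  constructor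
  · rintro ⟨i, v, hv, h⟩
    exact ⟨v, (List.mem_insertionSort _).1 (List.mem_of_getElem? hv), h⟩
  · rintro ⟨v, hv, h⟩
    obtain ⟨i, hi⟩ := List.mem_iff_getElem?.1 ((List.mem_insertionSort (· ≥ ·)).2 hv)
    exact ⟨i, v, hi, h⟩

open Classical in
/-- The value of `risk` in terms of the number `l` of recorded averages, the counter `s`, and the following
conditions: the next round is a switch; the reference policy has been followed; there is a good average; there is
a good threshold after the current one; the current threshold is good. -/
def riskBound (ρ : ℝ) (m l s : ℕ) (pend tr good later now : Prop) : ℝ :=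
  if l < m then
    ρ ^ (m - 1) + if good ∨ (¬ pend ∧ tr) then 0 else if pend then ρ ^ (m - l) else ρ ^ (m - 1 - l)
  else if later then ρ ^ (m - 1)
  else if now then if pend then ρ ^ (m - s) else if tr then 0 else ρ ^ (m - 1 - s)
  else 1

/-- An upper bound on the probability that in the rest of the block the controller moves past all thresholds that
are within `ε` of `μ`. Here `tr` says that the current iteration has followed the reference policy from its
beginning, and a fresh pair misses the reference policy with probability `ρ`. -/
def risk (ρ μ ε : ℝ) (m : ℕ) (c : Ctrl) (tr : Prop) : ℝ :=
  riskBound ρ m c.avgs.length c.fails c.pending tr (∃ v ∈ c.avgs, |v - μ| ≤ ε)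
    (∃ i, c.idx < i ∧ c.GoodAt μ ε i) (c.GoodAt μ ε c.idx)

section

variable {ρ μ ε : ℝ} {m : ℕ} {c : Ctrl} {tr : Prop}

lemma risk_nonneg (h0 : 0 ≤ ρ) : 0 ≤ risk ρ μ ε m c tr := by
  unfold risk riskBound
  split_ifs <;> positivity

lemma risk_congr {c' : Ctrl} {tr' : Prop} (h1 : c'.avgs = c.avgs) (h2 : c'.idx = c.idx) (h3 : c'.fails = c.fails)
    (h4 : c'.pending ↔ c.pending) (h5 : tr' ↔ tr) : risk ρ μ ε m c' tr' = risk ρ μ ε m c tr := by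
  unfold risk Ctrl.GoodAt
  rw [h1, h2, h3, propext h4, propext h5]

/-- Along the play tracking is only known to persist between switches: a pair that missed the
reference may still merge with it and count as tracking from the next iteration on. Monotonicity
absorbs such accidental hits. -/
lemma risk_mono (h0 : 0 ≤ ρ) {tr' : Prop} (h : tr → tr') : risk ρ μ ε m c tr' ≤ risk ρ μ ε m c tr := by
  have hpow : ∀ j, 0 ≤ ρ ^ j := fun j => by positivity
  unfold risk
  generalize (∃ v ∈ c.avgs, |v - μ| ≤ ε) = good
  generalize (∃ i, c.idx < i ∧ c.GoodAt μ ε i) = later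
  generalize c.GoodAt μ ε c.idx = now
  unfold riskBound
  split_ifs <;> first | exact le_rfl | exact hpow _ | (exfalso; tauto) | (simpa using hpow _)

/-- A fresh pair, which hits the reference policy with probability `1 - ρ`, does not increase the expected risk. -/
lemma risk_pending {c' : Ctrl} (hp : c.pending) (h1 : c'.avgs = c.avgs) (h2 : c'.idx = c.idx)
    (h3 : c'.fails = c.fails) (h4 : ¬ c'.pending) (h5 : c.fails < m) :
    (1 - ρ) * risk ρ μ ε m c' True + ρ * risk ρ μ ε m c' False ≤ risk ρ μ ε m c tr := by
  have hgood : c'.GoodAt μ ε = c.GoodAt μ ε := by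
    funext i; rw [Ctrl.GoodAt, Ctrl.GoodAt, h1]
  unfold risk
  rw [hgood, h1, h2, h3, eq_false h4, eq_true hp]
  generalize (∃ v ∈ c.avgs, |v - μ| ≤ ε) = good
  generalize (∃ i, c.idx < i ∧ c.GoodAt μ ε i) = later
  generalize c.GoodAt μ ε c.idx = now
  -- A hit makes this term vanish, a miss leaves one draw fewer, so the expectation balances
  -- exactly.
  have e1 : ∀ j < m, ρ * ρ ^ (m - 1 - j) = ρ ^ (m - j) := by
    intro j hj
    rw [← pow_succ']
    congr 1
    omega
  unfold riskBound
  by_cases hl : c.avgs.length < m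
  · have := e1 _ hl
    rw [if_pos hl, if_pos hl, if_pos hl]
    split_ifs <;> first | nlinarith | (exfalso; tauto)
  · have := e1 _ h5
    rw [if_neg hl, if_neg hl, if_neg hl]
    split_ifs <;> nlinarith

/-- The end of an iteration does not increase the risk, if the average is close to `μ` whenever the reference
policy was followed. -/
lemma risk_endIteration {a : ℝ} (h0 : 0 ≤ ρ) (h1 : ρ ≤ 1) (hp : ¬ c.pending) (hl : c.avgs.length ≤ m)
    (hf : c.fails < m) (hph : c.avgs.length < m → c.idx = 0 ∧ c.fails = 0)
    (ha : tr → |a - μ| ≤ ε) {c' : Ctrl} (e1 : c'.avgs = (c.endIteration ε m a).avgs)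
    (e2 : c'.idx = (c.endIteration ε m a).idx) (e3 : c'.fails = (c.endIteration ε m a).fails)
    (e4 : c'.pending ↔ (c.endIteration ε m a).pending) :
    risk ρ μ ε m c' tr ≤ risk ρ μ ε m c tr := by
  rw [risk_congr e1 e2 e3 e4 Iff.rfl]
  clear e1 e2 e3 e4
  have hpow : ∀ i j, i ≤ j → ρ ^ j ≤ ρ ^ i := fun i j hij => pow_le_pow_of_le_one h0 h1 hij
  by_cases hlt : c.avgs.length < m
  · obtain ⟨hi0, hf0⟩ := hph hlt
    have hE : c.endIteration ε m a = { c with count := 0, acc := 0, pending := True, avgs := c.avgs ++ [a] } := by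
      rw [Ctrl.endIteration, if_pos hlt]
    rw [hE]
    have hn : 0 ≤ ρ ^ (m - 1 - c.avgs.length) := by positivity
    have hn' : 0 ≤ ρ ^ (m - 1) := by positivity
    by_cases hG : (∃ v ∈ c.avgs, |v - μ| ≤ ε) ∨ tr
    · have hG' : ∃ v ∈ c.avgs ++ [a], |v - μ| ≤ ε := by
        rcases hG with ⟨v, hv, h⟩ | h
        · exact ⟨v, by simp [hv], h⟩
        · exact ⟨a, by simp, ha h⟩
      have hL : risk ρ μ ε m c tr = ρ ^ (m - 1) := by
        unfold risk riskBound
        rw [if_pos hlt, if_pos (hG.imp_right fun h => ⟨hp, h⟩), add_zero]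
      rw [hL]
      -- If `a` is the last average of phase I, the new risk is read from the phase II branches with
      -- `idx = fails = 0`. The summand `ρ ^ (m - 1)` carried through phase I is the reserve that
      -- pays for them.
      unfold risk riskBound
      simp only [List.length_append, List.length_singleton]
      split_ifs with i1 i2 i3 i4
      · simp
      · exact absurd (Or.inl hG') i2
      · exact le_rfl
      · exact hpow _ _ (by omega)
      · exfalso
        obtain ⟨i, hi⟩ := (Ctrl.exists_goodAt_iff μ ε
          { c with count := 0, acc := 0, pending := True, avgs := c.avgs ++ [a] }).2 hG'
        rcases Nat.eq_zero_or_pos i with rfl | h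
        · rw [← hi0] at hi
          exact i4 hi
        · exact i3 ⟨i, by simpa [hi0] using h, hi⟩
    · have hL : risk ρ μ ε m c tr = ρ ^ (m - 1) + ρ ^ (m - 1 - c.avgs.length) := by
        unfold risk riskBound
        rw [if_pos hlt, if_neg (fun h => hG (h.imp_right And.right)), if_neg hp]
      rw [hL]
      unfold risk riskBound
      simp only [List.length_append, List.length_singleton]
      split_ifs with i1 i2 i3 i4
      · linarith
      · rw [show m - (c.avgs.length + 1) = m - 1 - c.avgs.length by omega]
      · linarith
      · linarith [hpow (m - 1) (m - c.fails) (by omega)]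
      · rw [show m - 1 - c.avgs.length = 0 by omega]; simpa using hn'
  · have hE : (c.endIteration ε m a).avgs = c.avgs := by
      rw [Ctrl.endIteration, if_neg hlt]
    have hgood : (c.endIteration ε m a).GoodAt μ ε = c.GoodAt μ ε := by
      funext i; rw [Ctrl.GoodAt, Ctrl.GoodAt, hE]
    -- A good threshold is at most `μ + ε` and a tracked average at least `μ - ε`; this is the
    -- reason for the margin `2ε`.
    have hlow : tr → c.GoodAt μ ε c.idx → ¬ tooLow ε c.avgs c.idx a := by
      rintro ht ⟨v, hv, h⟩ ⟨v', hv', h'⟩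
      rw [hv] at hv'
      obtain rfl := Option.some.inj hv'
      have := abs_le.1 (ha ht)
      have := abs_le.1 h
      linarith
    have hidx : (c.endIteration ε m a).idx = c.idx ∧
        ((tooLow ε c.avgs c.idx a ∧ c.fails + 1 < m ∧ (c.endIteration ε m a).fails = c.fails + 1 ∧
            (c.endIteration ε m a).pending) ∨
          (¬ tooLow ε c.avgs c.idx a ∧ (c.endIteration ε m a).fails = c.fails ∧
            ¬ (c.endIteration ε m a).pending)) ∨
        (c.endIteration ε m a).idx = c.idx + 1 ∧ tooLow ε c.avgs c.idx a ∧ c.fails + 1 = m ∧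
          (c.endIteration ε m a).fails = 0 ∧ (c.endIteration ε m a).pending := by
      rw [Ctrl.endIteration, if_neg hlt]
      by_cases hb : tooLow ε c.avgs c.idx a
      · by_cases hb2 : m ≤ c.fails + 1
        · right
          simp only [hb, if_true, hb2, and_true, true_and]
          omega
        · left
          simp only [hb, if_true, hb2, if_false, and_true, true_and]
          left; omega
      · left
        have : ¬ m ≤ c.fails := by omega
        simp [hb, this]
    unfold risk
    rw [hE, hgood, eq_false hp]
    rcases hidx with ⟨hi, h⟩ | ⟨hi, hb, hfm, hf', hp'⟩
    · rw [hi]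
      unfold riskBound
      rw [if_neg hlt, if_neg hlt]
      generalize (∃ i, c.idx < i ∧ c.GoodAt μ ε i) = later
      generalize c.GoodAt μ ε c.idx = now at hlow ⊢
      rcases h with ⟨hb, hlm, hf', hp'⟩ | ⟨hb, hf', hp'⟩
      · have h2 := hpow (m - 1 - c.fails) (m - (c.fails + 1)) (by omega)
        rw [hf']
        split_ifs <;> first | exact le_rfl | exact h2 | (exfalso; tauto)
      · rw [hf']
        split_ifs <;> first | exact le_rfl | (exfalso; tauto)
    · have hex : (∃ i, c.idx < i ∧ c.GoodAt μ ε i) ↔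
          (∃ i, c.idx + 1 < i ∧ c.GoodAt μ ε i) ∨ c.GoodAt μ ε (c.idx + 1) := by
        constructor
        · rintro ⟨i, hi, hgi⟩
          rcases Nat.lt_or_ge (c.idx + 1) i with h | h
          · exact Or.inl ⟨i, h, hgi⟩
          · have : i = c.idx + 1 := by omega
            exact Or.inr (this ▸ hgi)
        · rintro (⟨i, hi, hgi⟩ | h)
          · exact ⟨i, by omega, hgi⟩
          · exact ⟨_, by omega, h⟩
      have h3 := hpow (m - 1) (m - 0) (by omega)
      -- The threshold moves on at the `m`-th failure. If it was the last good one, the untracked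
      -- iteration had already used up all draws, and its risk was already `1`.
      have h4 : ρ ^ (m - 1 - c.fails) = 1 := by rw [show m - 1 - c.fails = 0 by omega, pow_zero]
      rw [hi, hf', propext hex]
      unfold riskBound
      rw [if_neg hlt, if_neg hlt, h4]
      clear hex
      generalize (∃ i, c.idx + 1 < i ∧ c.GoodAt μ ε i) = later
      generalize c.GoodAt μ ε (c.idx + 1) = next
      generalize c.GoodAt μ ε c.idx = now at hlow ⊢
      split_ifs <;> first | exact le_rfl | exact h3 | (exfalso; tauto)

/-- An iteration that is not too low has a large average, as long as a good threshold is left. -/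
lemma le_of_not_tooLow {a : ℝ} (hr : risk ρ μ ε m c tr < 1) (hl : m ≤ c.avgs.length)
    (hb : ¬ tooLow ε c.avgs c.idx a) : μ - 3 * ε ≤ a := by
  have : ∃ i, c.idx ≤ i ∧ c.GoodAt μ ε i := by
    by_contra hcon
    have h1 : ¬ ∃ i, c.idx < i ∧ c.GoodAt μ ε i := by
      rintro ⟨i, hi, h⟩; exact hcon ⟨i, hi.le, h⟩
    have h2 : ¬ c.GoodAt μ ε c.idx := fun h => hcon ⟨_, le_rfl, h⟩
    unfold risk riskBound at hr
    rw [if_neg (not_lt.2 hl), if_neg h1, if_neg h2] at hr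
    exact lt_irrefl _ hr
  obtain ⟨i, hi, v, hv, h⟩ := this
  obtain ⟨hlt, hv⟩ := List.getElem?_eq_some_iff.1 hv
  have hlt' : c.idx < (c.avgs.insertionSort (· ≥ ·)).length := by omega
  -- Thresholds descend, so the current one is at least a good one, hence at least `μ - ε`; passing
  -- the test costs another `2ε`.
  have hge : (c.avgs.insertionSort (· ≥ ·))[i] ≤ (c.avgs.insertionSort (· ≥ ·))[c.idx] := by
    rcases hi.eq_or_lt with h | h
    · simp [h]
    · exact List.pairwise_iff_getElem.1 (List.pairwise_insertionSort (· ≥ ·) c.avgs) _ _ hlt' hlt h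
  have := abs_le.1 h
  by_contra hcon
  exact hb ⟨_, List.getElem?_eq_getElem hlt', by linarith⟩

/-- One summand is for recording no good average in phase I, the other for passing the good
thresholds in phase II. The exponent is `m - 1` because the first iteration of a block starts from
an arbitrary pair, not from a fresh draw. -/
lemma risk_start (h0 : 0 ≤ ρ) (hm : 0 < m) : risk ρ μ ε m Ctrl.start tr ≤ 2 * ρ ^ (m - 1) := by
  have : 0 ≤ ρ ^ (m - 1) := by positivity
  unfold risk riskBound Ctrl.start
  simp only [List.length_nil, hm, if_true, if_false, Nat.sub_zero]
  split_ifs <;> linarith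

end

/-! ### The analysis of one block -/

/-- The number of switches decided on so far in the block. -/
def Ctrl.switches (m : ℕ) (c : Ctrl) : ℕ := c.avgs.length + c.idx * m + c.fails

open Classical in
/-- The invariants of the controller. -/
structure Ctrl.Valid (m len : ℕ) (c : Ctrl) : Prop where
  count_lt : c.count < len
  acc_nonneg : 0 ≤ c.acc
  pend : c.pending → c.count = 0 ∧ c.acc = 0
  length_le : c.avgs.length ≤ m
  phase_one : c.avgs.length < m → c.idx = 0 ∧ c.fails = 0
  fails_lt : c.fails < m
  idx_le : c.idx ≤ m
  fails_eq : c.idx = m → c.fails = 0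
  time : ∃ q, c.elapsed + (if c.pending then 1 else 0) = q * len + c.switches m + c.count

lemma Ctrl.valid_start {m len : ℕ} (hm : 0 < m) (hlen : 0 < len) : Ctrl.start.Valid m len where
  count_lt := hlen
  acc_nonneg := le_rfl
  pend h := h.elim
  length_le := Nat.zero_le _
  phase_one _ := ⟨rfl, rfl⟩
  fails_lt := hm
  idx_le := Nat.zero_le _
  fails_eq _ := rfl
  time := ⟨0, by simp [Ctrl.start, Ctrl.switches]⟩

section

variable {ε : ℝ} {m len : ℕ} {c : Ctrl}

/-- There are `m` switches in phase I and at most `m` for each of the `m` thresholds. -/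
lemma Ctrl.Valid.switches_le (h : c.Valid m len) : c.switches m ≤ m + m * m := by
  have h1 := h.length_le
  have h2 := h.fails_lt
  unfold Ctrl.switches
  rcases h.idx_le.eq_or_lt with h3 | h3
  · rw [h3, h.fails_eq h3]; omega
  · have : (c.idx + 1) * m ≤ m * m := Nat.mul_le_mul_right _ h3
    linarith

lemma Ctrl.Valid.count_le (h : c.Valid m len) : c.count ≤ c.elapsed := by
  obtain ⟨q, hq⟩ := h.time
  by_cases hp : c.pending
  · simp [(h.pend hp).1]
  · rw [if_neg hp] at hq; omega

lemma tooLow_length {a : ℝ} (h : tooLow ε c.avgs c.idx a) : c.idx < c.avgs.length := by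
  obtain ⟨v, hv, _⟩ := h
  have := (List.getElem?_eq_some_iff.1 hv).1
  rwa [List.length_insertionSort] at this

/-- What changes at the end of an iteration: there is one more switch exactly if the next round is one. -/
lemma Ctrl.Valid.endIteration_cases (h : c.Valid m len) (a : ℝ) :
    (c.endIteration ε m a).count = 0 ∧ (c.endIteration ε m a).acc = 0 ∧
      (((c.endIteration ε m a).pending ∧ (c.endIteration ε m a).switches m = c.switches m + 1) ∨
        (¬ (c.endIteration ε m a).pending ∧ (c.endIteration ε m a).switches m = c.switches m ∧
          m ≤ c.avgs.length ∧ ¬ tooLow ε c.avgs c.idx a)) ∧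
      (c.endIteration ε m a).avgs.length ≤ m ∧
      ((c.endIteration ε m a).avgs.length < m →
        (c.endIteration ε m a).idx = 0 ∧ (c.endIteration ε m a).fails = 0) ∧
      (c.endIteration ε m a).fails < m ∧ (c.endIteration ε m a).idx ≤ m ∧
      ((c.endIteration ε m a).idx = m → (c.endIteration ε m a).fails = 0) := by
  have h2 := h.fails_lt
  by_cases hlt : c.avgs.length < m
  · have h1 := h.phase_one hlt
    rw [Ctrl.endIteration, if_pos hlt]
    simp only [Ctrl.switches, List.length_append, List.length_singleton, true_and, not_true_eq_false, false_and,
      or_false, h1, implies_true, and_true]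
    omega
  · have hl : c.avgs.length = m := le_antisymm h.length_le (not_lt.1 hlt)
    rw [Ctrl.endIteration, if_neg hlt]
    by_cases hb : tooLow ε c.avgs c.idx a
    · have h3 := tooLow_length hb
      rw [hl] at h3
      by_cases hs : m ≤ c.fails + 1
      · simp only [Ctrl.switches, hb, if_true, hs, hl, true_and, not_true_eq_false, false_and, or_false,
          lt_irrefl, false_imp_iff, implies_true, and_true, le_refl, add_mul]
        omega
      · simp only [Ctrl.switches, hb, if_true, hs, hl, true_and, not_true_eq_false, false_and, or_false,
          lt_irrefl, false_imp_iff, if_false, le_refl]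
        omega
    · have h3 := h.idx_le
      have h4 := h.fails_eq
      have hs : ¬ m ≤ c.fails := by omega
      simp only [Ctrl.switches, hb, hs, hl, if_false, true_and, false_and, false_or, not_false_eq_true,
        le_refl, and_true, lt_irrefl, false_imp_iff]
      exact ⟨h2, h3, h4⟩

/-- The possible rounds inside a block. -/
lemma Ctrl.Valid.step_cases {b : ℕ} {x : ℝ} (h : c.Valid m len) (he : c.elapsed + 1 < b) :
    (c.step ε m len b x).elapsed = c.elapsed + 1 ∧
    ((c.pending ∧ ¬ (c.step ε m len b x).pending ∧
        (c.step ε m len b x).count = c.count ∧ (c.step ε m len b x).acc = c.acc ∧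
        (c.step ε m len b x).avgs = c.avgs ∧ (c.step ε m len b x).idx = c.idx ∧
        (c.step ε m len b x).fails = c.fails) ∨
      (¬ c.pending ∧ c.count + 1 < len ∧ ¬ (c.step ε m len b x).pending ∧
        (c.step ε m len b x).count = c.count + 1 ∧ (c.step ε m len b x).acc = c.acc + x ∧
        (c.step ε m len b x).avgs = c.avgs ∧ (c.step ε m len b x).idx = c.idx ∧
        (c.step ε m len b x).fails = c.fails) ∨
      (¬ c.pending ∧ c.count + 1 = len ∧
        c.step ε m len b x =
          { c.endIteration ε m ((c.acc + x) / len) with elapsed := c.elapsed + 1 })) := by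
  have hlt := h.count_lt
  rw [Ctrl.step, if_pos he, Ctrl.round]
  by_cases hp : c.pending
  · rw [if_pos hp]; simp [hp]
  · rw [if_neg hp]
    by_cases hc : c.count + 1 < len
    · rw [if_pos hc]; simp [hp, hc]
    · rw [if_neg hc]
      refine ⟨rfl, Or.inr (Or.inr ⟨hp, by omega, rfl⟩)⟩

lemma Ctrl.Valid.step {b : ℕ} {x : ℝ} (h : c.Valid m len) (hx : 0 ≤ x) (he : c.elapsed + 1 < b) :
    (c.step ε m len b x).Valid m len := by
  obtain ⟨e1, hcase⟩ := h.step_cases (ε := ε) (x := x) he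
  obtain ⟨q, hq⟩ := h.time
  rcases hcase with ⟨hp, hp', e2, e3, e4, e5, e6⟩ | ⟨hp, hc, hp', e2, e3, e4, e5, e6⟩ | ⟨hp, hc, e⟩
  · refine ⟨e2 ▸ h.count_lt, e3 ▸ h.acc_nonneg, fun hh => absurd hh hp', e4 ▸ h.length_le, ?_, e6 ▸ h.fails_lt,
      e5 ▸ h.idx_le, ?_, q, ?_⟩
    · rw [e4, e5, e6]; exact h.phase_one
    · rw [e5, e6]; exact h.fails_eq
    · rw [if_pos hp] at hq
      rw [if_neg hp', e1, e2, Ctrl.switches, e4, e5, e6]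
      exact hq
  · refine ⟨e2 ▸ hc, e3 ▸ add_nonneg h.acc_nonneg hx, fun hh => absurd hh hp', e4 ▸ h.length_le, ?_,
      e6 ▸ h.fails_lt, e5 ▸ h.idx_le, ?_, q, ?_⟩
    · rw [e4, e5, e6]; exact h.phase_one
    · rw [e5, e6]; exact h.fails_eq
    · rw [if_neg hp] at hq
      rw [if_neg hp', e1, e2, Ctrl.switches, e4, e5, e6]
      rw [Ctrl.switches] at hq
      omega
  · obtain ⟨f1, f2, f3, f4, f5, f6, f7, f8⟩ := h.endIteration_cases (ε := ε) ((c.acc + x) / len)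
    rw [if_neg hp] at hq
    rw [e]
    refine ⟨?_, f2.ge, fun _ => ⟨f1, f2⟩, f4, f5, f6, f7, f8, q + 1, ?_⟩
    · change (c.endIteration ε m _).count < len
      rw [f1]; omega
    · classical
      change c.elapsed + 1 + (if (c.endIteration ε m ((c.acc + x) / len)).pending then 1 else 0) =
        (q + 1) * len + (c.endIteration ε m ((c.acc + x) / len)).switches m +
          (c.endIteration ε m ((c.acc + x) / len)).count
      rw [f1, add_mul]
      rcases f3 with ⟨g1, g2⟩ | ⟨g1, g2, -⟩
      · rw [if_pos g1, g2]; omega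
      · rw [if_neg g1, g2]; omega

end

/-! ### The potential argument in a stable block -/

section

variable {n k S : ℕ} (P : Fin k → StatefulPolicy n S) (r : ℕ → Fin n → unitInterval) (j : Fin k)

/-- The reward of the policy `P j` in round `t`, had it been followed from the beginning. -/
def reference (t : ℕ) : ℝ := (r t ((P j).action ((P j).state r t)) : ℝ)

lemma reference_nonneg (t : ℕ) : 0 ≤ reference P r j t := (r t _).2.1

lemma reference_le_one (t : ℕ) : reference P r j t ≤ 1 := (r t _).2.2

/-- The current iteration has followed the policy `P j` from its beginning up to round `t`. -/
def Tracking (t : ℕ) (x : Ctrl × (Fin k × Fin S)) : Prop :=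
  x.2 = (j, (P j).state r t) ∧
    ∃ s, t = s + x.1.count ∧ x.1.acc = ∑ u ∈ Finset.range x.1.count, reference P r j (s + u)

variable {P r j}

lemma Tracking.payoff_eq {t : ℕ} {x : Ctrl × (Fin k × Fin S)} (h : Tracking P r j t x) :
    payoff P r t x = reference P r j t := by
  rw [payoff, h.1, reference]

/-- Sums over a window change by at most the shift when it is shifted. -/
lemma abs_sum_shift_le {f : ℕ → ℝ} (h0 : ∀ t, 0 ≤ f t) (h1 : ∀ t, f t ≤ 1) (s σ len : ℕ) :
    |∑ u ∈ Finset.range len, f (s + σ + u) - ∑ u ∈ Finset.range len, f (s + u)| ≤ σ := by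
  -- Both windows lie in one of length `σ + len`, from which they omit the first or the last `σ`
  -- terms.
  have e1 := Finset.sum_range_add (fun u => f (s + u)) σ len
  have e2 := Finset.sum_range_add (fun u => f (s + u)) len σ
  rw [add_comm σ len] at e1
  have hb : ∀ g : ℕ → ℝ, (∀ u, 0 ≤ g u) → (∀ u, g u ≤ 1) →
      0 ≤ ∑ u ∈ Finset.range σ, g u ∧ ∑ u ∈ Finset.range σ, g u ≤ σ := by
    intro g hg0 hg1
    refine ⟨Finset.sum_nonneg fun u _ => hg0 u, ?_⟩
    calc _ ≤ ∑ u ∈ Finset.range σ, (1 : ℝ) := Finset.sum_le_sum fun u _ => hg1 u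
      _ = σ := by simp
  have h3 := hb (fun u => f (s + u)) (fun _ => h0 _) (fun _ => h1 _)
  have h4 := hb (fun u => f (s + (len + u))) (fun _ => h0 _) (fun _ => h1 _)
  simp only [← add_assoc] at e1 e2 h4 ⊢
  rw [abs_le]
  constructor <;> linarith

variable {ε μ : ℝ} {m len d t₀ : ℕ}

/-- If an iteration follows the reference policy in a block where it is stable, its average is close to `μ`. -/
lemma Tracking.abs_average_sub_le {x : Ctrl × (Fin k × Fin S)} (h : Tracking P r j (t₀ + x.1.elapsed) x)
    (hv : x.1.Valid m len) (hp : ¬ x.1.pending) (hc : x.1.count + 1 = len) (he : x.1.elapsed < d * len)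
    (hM : ((m + m * m : ℕ) : ℝ) ≤ ε / 2 * len)
    (hgood : ∀ q < d, |(∑ u ∈ Finset.range len, reference P r j (t₀ + q * len + u)) / len - μ| ≤ ε / 2) :
    |(x.1.acc + payoff P r (t₀ + x.1.elapsed) x) / len - μ| ≤ ε := by
  have hpay := h.payoff_eq
  obtain ⟨-, s, hs, hacc⟩ := h
  obtain ⟨q, hq⟩ := hv.time
  rw [if_neg hp, add_zero] at hq
  have hqd : q < d := by
    by_contra hcon
    have : d * len ≤ q * len := Nat.mul_le_mul_right _ (not_lt.1 hcon)
    omega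
  have hlen : (0 : ℝ) < len := by exact_mod_cast (show 0 < len by omega)
  -- With `q` iterations completed and no switch pending, the current iteration is the `q`-th window
  -- of the block, delayed by the switches so far.
  have hs' : s = t₀ + q * len + x.1.switches m := by omega
  have hsum : x.1.acc + payoff P r (t₀ + x.1.elapsed) x =
      ∑ u ∈ Finset.range len, reference P r j (t₀ + q * len + x.1.switches m + u) := by
    rw [hpay, hacc, ← hs', ← hc, Finset.sum_range_succ, hs]
  have h1 := abs_sum_shift_le (reference_nonneg P r j) (reference_le_one P r j) (t₀ + q * len)
    (x.1.switches m) len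
  have h2 : (x.1.switches m : ℝ) ≤ ε / 2 * len := le_trans (by exact_mod_cast hv.switches_le) hM
  rw [← hsum] at h1
  have h3 := hgood q hqd
  have h4 : |(x.1.acc + payoff P r (t₀ + x.1.elapsed) x) / len -
      (∑ u ∈ Finset.range len, reference P r j (t₀ + q * len + u)) / len| ≤ ε / 2 := by
    rw [← sub_div, abs_div, abs_of_pos hlen, div_le_iff₀ hlen]
    exact h1.trans h2
  rw [abs_le] at *
  constructor <;> linarith

lemma payoff_nonneg (t : ℕ) (x : Ctrl × (Fin k × Fin S)) : 0 ≤ payoff P r t x := (r t _).2.1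

/-- Averaging a lower bound over the draws. -/
lemma le_blockValue_succ [NeZero k] [NeZero S] {b N t : ℕ} {x : Ctrl × (Fin k × Fin S)} {a : ℝ}
    (h : ∀ z, a ≤ blockValue P r ε m len b N (t + 1) (advance P r ε m len b t x z)) :
    payoff P r t x + a ≤ blockValue P r ε m len b (N + 1) t x := by
  rw [blockValue, chainValue]
  have hK : (0 : ℝ) < Fintype.card (Fin k × Fin S) := by exact_mod_cast Fintype.card_pos
  gcongr
  rw [le_div_iff₀ hK]
  calc a * Fintype.card (Fin k × Fin S) = ∑ _z : Fin k × Fin S, a := by simp [mul_comm]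
    _ ≤ _ := Finset.sum_le_sum fun z _ => h z

/-- Averaging a lower bound over the draws, when one draw is special. -/
lemma le_blockValue_succ_of_special [NeZero k] [NeZero S] {b N t : ℕ} {x : Ctrl × (Fin k × Fin S)}
    {a₁ a₂ : ℝ} (z₀ : Fin k × Fin S)
    (h₁ : a₁ ≤ blockValue P r ε m len b N (t + 1) (advance P r ε m len b t x z₀))
    (h₂ : ∀ z, a₂ ≤ blockValue P r ε m len b N (t + 1) (advance P r ε m len b t x z)) :
    payoff P r t x + (prob k S * a₁ + (1 - prob k S) * a₂) ≤ blockValue P r ε m len b (N + 1) t x := by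
  rw [blockValue, chainValue]
  have hK : (0 : ℝ) < Fintype.card (Fin k × Fin S) := by exact_mod_cast Fintype.card_pos
  have hprob : prob k S = 1 / Fintype.card (Fin k × Fin S) := by simp [prob]
  gcongr
  rw [le_div_iff₀ hK, hprob]
  have h3 : ∑ z : Fin k × Fin S, (a₂ + if z = z₀ then a₁ - a₂ else 0) ≤
      ∑ z, blockValue P r ε m len b N (t + 1) (advance P r ε m len b t x z) := by
    refine Finset.sum_le_sum fun z _ => ?_
    split_ifs with hz
    · rw [hz]; linarith
    · simpa using h₂ z
  rw [Finset.sum_add_distrib, Finset.sum_ite_eq' Finset.univ z₀, if_pos (Finset.mem_univ _)] at h3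
  simp only [Finset.sum_const, Finset.card_univ, nsmul_eq_mul] at h3
  refine le_trans (le_of_eq ?_) h3
  field_simp
  ring

lemma blockValue_nonneg {b : ℕ} (N t : ℕ) (x : Ctrl × (Fin k × Fin S)) :
    0 ≤ blockValue P r ε m len b N t x := by
  induction N generalizing t x with
  | zero => exact le_rfl
  | succ N ih =>
    rw [blockValue, chainValue]
    exact add_nonneg (payoff_nonneg _ _) (div_nonneg (Finset.sum_nonneg fun z _ => ih _ _) (by positivity))

lemma advance_fst {b t : ℕ} (x : Ctrl × (Fin k × Fin S)) (z : Fin k × Fin S) :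
    (advance P r ε m len b t x z).1 = x.1.step ε m len b (payoff P r t x) := rfl

/-- The value after the block is a lower bound for the value in the block. -/
lemma le_blockValue_of_le_start [NeZero k] [NeZero S] {b N : ℕ} {K : ℝ}
    (hK : ∀ z, K ≤ blockValue P r ε m len b N (t₀ + b) (Ctrl.start, z)) (i : ℕ) (x : Ctrl × (Fin k × Fin S))
    (he : x.1.elapsed + (i + 1) = b) :
    K ≤ blockValue P r ε m len b (N + (i + 1)) (t₀ + x.1.elapsed) x := by
  induction i generalizing x with
  | zero =>
    refine le_trans (by linarith [payoff_nonneg (P := P) (r := r) (t₀ + x.1.elapsed) x])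
      (le_blockValue_succ (a := K) fun z => ?_)
    have : advance P r ε m len b (t₀ + x.1.elapsed) x z =
        (Ctrl.start, (advance P r ε m len b (t₀ + x.1.elapsed) x z).2) := by
      refine Prod.ext ?_ rfl
      rw [advance_fst, Ctrl.step, if_neg (by omega)]
    rw [this, show t₀ + x.1.elapsed + 1 = t₀ + b by omega]
    exact hK _
  | succ i ih =>
    refine le_trans (by linarith [payoff_nonneg (P := P) (r := r) (t₀ + x.1.elapsed) x])
      (le_blockValue_succ (a := K) fun z => ?_)
    have hel : (advance P r ε m len b (t₀ + x.1.elapsed) x z).1.elapsed = x.1.elapsed + 1 := by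
      rw [advance_fst, Ctrl.step, if_pos (by omega)]
    have := ih (advance P r ε m len b (t₀ + x.1.elapsed) x z) (by omega)
    rwa [hel] at this

open Classical in
/-- A lower bound on the expected reward in the rest of the block, in which rounds are worth `v`. -/
def guarantee (P : Fin k → StatefulPolicy n S) (r : ℕ → Fin n → unitInterval) (j : Fin k) (ε μ v : ℝ)
    (m len b t₀ : ℕ) (x : Ctrl × (Fin k × Fin S)) : ℝ :=
  v * (b - x.1.elapsed) + v * x.1.count - x.1.acc - (len + 1) * ((m + m * m : ℕ) - x.1.switches m)
    - (if x.1.pending then 1 else 0) - len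
    - b * risk (1 - prob k S) μ ε m x.1 (Tracking P r j (t₀ + x.1.elapsed) x)

/-- The term `b * risk` then outweighs the worth of the whole block, so once the good thresholds may
all be gone nothing more is claimed. -/
lemma guarantee_nonpos_of_one_le_risk {v : ℝ} {b : ℕ} {x : Ctrl × (Fin k × Fin S)} (hv0 : 0 ≤ v) (hv1 : v ≤ 1)
    (hx : x.1.Valid m len) (hb : x.1.elapsed ≤ b)
    (hr : 1 ≤ risk (1 - prob k S) μ ε m x.1 (Tracking P r j (t₀ + x.1.elapsed) x)) :
    guarantee P r j ε μ v m len b t₀ x ≤ 0 := by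
  classical
  unfold guarantee
  have h1 : (x.1.switches m : ℝ) ≤ (m + m * m : ℕ) := by exact_mod_cast hx.switches_le
  have h2 := hx.acc_nonneg
  have h3 : (x.1.count : ℝ) ≤ x.1.elapsed := by exact_mod_cast hx.count_le
  have h4 : (0 : ℝ) ≤ if x.1.pending then 1 else 0 := by split_ifs <;> norm_num
  have h5 : (b : ℝ) * 1 ≤ b * risk (1 - prob k S) μ ε m x.1 (Tracking P r j (t₀ + x.1.elapsed) x) :=
    mul_le_mul_of_nonneg_left hr (by positivity)
  have h6 : 0 ≤ ((len : ℝ) + 1) * ((m + m * m : ℕ) - x.1.switches m) :=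
    mul_nonneg (by positivity) (by linarith)
  have h7 : v * (b - x.1.elapsed) + v * x.1.count ≤ b := by
    have : (x.1.elapsed : ℝ) ≤ b := by exact_mod_cast hb
    nlinarith
  have h8 : (0 : ℝ) ≤ len := by positivity
  linarith

/-- The reference policy is followed as long as there is no switch. -/
lemma Tracking.advance_snd {b t : ℕ} {x : Ctrl × (Fin k × Fin S)} (h : Tracking P r j t x) (hp : ¬ x.1.pending)
    (z : Fin k × Fin S) : (advance P r ε m len b t x z).2 = (j, (P j).state r (t + 1)) := by
  rw [advance, h.1]
  simp only [hp, if_false, StatefulPolicy.state]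

/-- In a block in which the reference policy is stable, the expected reward is at least the guarantee. -/
theorem add_guarantee_le_blockValue [NeZero k] [NeZero S] {b N : ℕ} {K v : ℝ}
    (hb : b = d * len) (hv0 : 0 ≤ v) (hv1 : v ≤ 1) (hv : v = 0 ∨ v ≤ μ - 3 * ε)
    (hM : ((m + m * m : ℕ) : ℝ) ≤ ε / 2 * len)
    (hgood : ∀ q < d, |(∑ u ∈ Finset.range len, reference P r j (t₀ + q * len + u)) / len - μ| ≤ ε / 2)
    (hK : ∀ z, K ≤ blockValue P r ε m len b N (t₀ + b) (Ctrl.start, z)) (i : ℕ) (x : Ctrl × (Fin k × Fin S))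
    (hx : x.1.Valid m len) (he : x.1.elapsed + (i + 1) = b) :
    K + guarantee P r j ε μ v m len b t₀ x ≤
      blockValue P r ε m len b (N + (i + 1)) (t₀ + x.1.elapsed) x := by
  have hS : (1 : ℝ) ≤ S := by exact_mod_cast NeZero.one_le
  have hk : (1 : ℝ) ≤ k := by exact_mod_cast NeZero.one_le
  have hkS : (1 : ℝ) ≤ k * S := by nlinarith
  have hp0 : 0 ≤ prob k S := by unfold prob; positivity
  have hp1 : prob k S ≤ 1 := by unfold prob; rw [div_le_one (by positivity)]; exact hkS
  have hρ0 : 0 ≤ 1 - prob k S := by linarith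
  have hρ1 : 1 - prob k S ≤ 1 := by linarith
  -- A nonpositive guarantee holds because rewards are nonnegative. Otherwise the risk is below `1`,
  -- as `le_of_not_tooLow` requires.
  by_cases hneg : guarantee P r j ε μ v m len b t₀ x ≤ 0
  · linarith [le_blockValue_of_le_start hK i x he]
  have hrisk : risk (1 - prob k S) μ ε m x.1 (Tracking P r j (t₀ + x.1.elapsed) x) < 1 := by
    by_contra hcon
    exact hneg (guarantee_nonpos_of_one_le_risk hv0 hv1 hx (by omega) (not_lt.1 hcon))
  -- The potential settles an iteration only at its end, whence `v * count - acc`. It reserves `len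
  -- + 1` for every switch still possible, `1` for a pending switch round, and `len` for the
  -- iteration cut off by the end of the block.
  induction i generalizing x with
  | zero =>
    exfalso
    apply hneg
    classical
    unfold guarantee
    have h1 : (x.1.switches m : ℝ) ≤ (m + m * m : ℕ) := by exact_mod_cast hx.switches_le
    have h2 := hx.acc_nonneg
    have h3 : (x.1.count : ℝ) + 1 ≤ len := by exact_mod_cast hx.count_lt
    have h4 : (0 : ℝ) ≤ if x.1.pending then 1 else 0 := by split_ifs <;> norm_num
    have h5 : 0 ≤ (b : ℝ) * risk (1 - prob k S) μ ε m x.1 (Tracking P r j (t₀ + x.1.elapsed) x) :=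
      mul_nonneg (by positivity) (risk_nonneg hρ0)
    have h6 : 0 ≤ ((len : ℝ) + 1) * ((m + m * m : ℕ) - x.1.switches m) :=
      mul_nonneg (by positivity) (by linarith)
    have h7 : (b : ℝ) = x.1.elapsed + 1 := by exact_mod_cast he.symm
    have h8 : v * (b - x.1.elapsed) + v * x.1.count ≤ len := by
      rw [h7]
      nlinarith
    linarith
  | succ i ih =>
    have hlt : x.1.elapsed + 1 < b := by omega
    have hstep := hx.step (ε := ε) (payoff_nonneg (P := P) (r := r) (t₀ + x.1.elapsed) x) hlt
    obtain ⟨e1, hcase⟩ := hx.step_cases (ε := ε) (x := payoff P r (t₀ + x.1.elapsed) x) hlt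
    have hy0 := payoff_nonneg (P := P) (r := r) (t₀ + x.1.elapsed) x
    have hmain : ∀ z, K + guarantee P r j ε μ v m len b t₀ (advance P r ε m len b (t₀ + x.1.elapsed) x z) ≤
        blockValue P r ε m len b (N + (i + 1)) (t₀ + x.1.elapsed + 1)
          (advance P r ε m len b (t₀ + x.1.elapsed) x z) := by
      intro z
      have hel : (advance P r ε m len b (t₀ + x.1.elapsed) x z).1.elapsed = x.1.elapsed + 1 := e1
      rw [show t₀ + x.1.elapsed + 1 = t₀ + (advance P r ε m len b (t₀ + x.1.elapsed) x z).1.elapsed by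
        rw [hel]; omega]
      by_cases hneg' : guarantee P r j ε μ v m len b t₀ (advance P r ε m len b (t₀ + x.1.elapsed) x z) ≤ 0
      · linarith [le_blockValue_of_le_start hK i (advance P r ε m len b (t₀ + x.1.elapsed) x z) (by omega)]
      · refine ih _ hstep (by omega) hneg' ?_
        by_contra hcon
        exact hneg' (guarantee_nonpos_of_one_le_risk hv0 hv1 hstep (by omega) (not_lt.1 hcon))
    have hbv : (0 : ℝ) ≤ b := by positivity
    have hcast : ((x.1.elapsed + 1 : ℕ) : ℝ) = x.1.elapsed + 1 := by push_cast; ring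
    rcases hcase with ⟨hp, hp', e2, e3, e4, e5, e6⟩ | ⟨hp, hc, hp', e2, e3, e4, e5, e6⟩ | ⟨hp, hc, e⟩
    · have hsw : (x.1.step ε m len b (payoff P r (t₀ + x.1.elapsed) x)).switches m = x.1.switches m := by
        rw [Ctrl.switches, e4, e5, e6, Ctrl.switches]
      have hrp := risk_pending (ρ := 1 - prob k S) (μ := μ) (ε := ε)
        (tr := Tracking P r j (t₀ + x.1.elapsed) x) hp e4 e5 e6 hp' hx.fails_lt
      set c' := x.1.step ε m len b (payoff P r (t₀ + x.1.elapsed) x) with hc'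
      obtain ⟨hc0, ha0⟩ := hx.pend hp
      set base : ℝ := K + (v * (b - (x.1.elapsed + 1)) - (len + 1) * ((m + m * m : ℕ) - x.1.switches m) - len)
        with hbase
      have hguar : ∀ z, K + guarantee P r j ε μ v m len b t₀ (advance P r ε m len b (t₀ + x.1.elapsed) x z) =
          base - b * risk (1 - prob k S) μ ε m c' (Tracking P r j (t₀ + (x.1.elapsed + 1))
            (advance P r ε m len b (t₀ + x.1.elapsed) x z)) := by
        intro z
        rw [guarantee, advance_fst, ← hc', e1, e2, e3, hc0, ha0, if_neg hp', hsw, hcast]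
        simp only [hbase, Nat.cast_zero]
        ring
      have hspecial := le_blockValue_succ_of_special (N := N + (i + 1)) (t := t₀ + x.1.elapsed) (x := x)
        (P := P) (r := r) (ε := ε) (m := m) (len := len) (b := b)
        (a₁ := base - b * risk (1 - prob k S) μ ε m c' True)
        (a₂ := base - b * risk (1 - prob k S) μ ε m c' False)
        -- The one draw that lands on the reference in its current state; as `count` and `acc` are
        -- `0`, the new iteration tracks from its beginning.
        (j, (P j).state r (t₀ + (x.1.elapsed + 1)))
        (by
          refine le_trans (le_of_eq ?_) (hmain _)
          rw [hguar, risk_congr rfl rfl rfl Iff.rfl]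
          refine ⟨fun _ => ⟨?_, t₀ + (x.1.elapsed + 1), ?_, ?_⟩, fun _ => trivial⟩
          · rw [advance]; simp only [hp, if_true]
          · rw [advance_fst, ← hc', e2, hc0, add_zero]
          · rw [advance_fst, ← hc', e2, e3, hc0, ha0]; simp)
        (by
          intro z
          refine le_trans ?_ (hmain z)
          rw [hguar]
          have := risk_mono (ρ := 1 - prob k S) (μ := μ) (ε := ε) (m := m) (c := c') hρ0 (tr := False)
            (tr' := Tracking P r j (t₀ + (x.1.elapsed + 1))
              (advance P r ε m len b (t₀ + x.1.elapsed) x z)) False.elim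
          nlinarith)
      refine le_trans ?_ hspecial
      have hmul := mul_le_mul_of_nonneg_left hrp hbv
      rw [guarantee, hc0, ha0, if_pos hp]
      simp only [hbase, Nat.cast_zero]
      nlinarith
    · have hsw : (x.1.step ε m len b (payoff P r (t₀ + x.1.elapsed) x)).switches m = x.1.switches m := by
        rw [Ctrl.switches, e4, e5, e6, Ctrl.switches]
      refine le_trans ?_ (le_blockValue_succ (a := K + (guarantee P r j ε μ v m len b t₀ x -
        payoff P r (t₀ + x.1.elapsed) x)) fun z => le_trans ?_ (hmain z))
      · linarith
      · have htr : Tracking P r j (t₀ + x.1.elapsed) x →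
            Tracking P r j (t₀ + (x.1.elapsed + 1)) (advance P r ε m len b (t₀ + x.1.elapsed) x z) := by
          intro h
          refine ⟨h.advance_snd hp z, ?_⟩
          have hpay := h.payoff_eq
          obtain ⟨-, s, hs, hacc⟩ := h
          refine ⟨s, ?_, ?_⟩
          · rw [advance_fst, e2]; omega
          · rw [advance_fst, e2, e3, hacc, Finset.sum_range_succ, hpay, hs]
        have h1 := risk_mono (ρ := 1 - prob k S) (μ := μ) (ε := ε) (m := m)
          (c := x.1.step ε m len b (payoff P r (t₀ + x.1.elapsed) x)) hρ0 htr
        rw [risk_congr (tr' := Tracking P r j (t₀ + x.1.elapsed) x) e4 e5 e6 (by tauto) Iff.rfl] at h1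
        have h2 := mul_le_mul_of_nonneg_left h1 hbv
        rw [guarantee, guarantee, advance_fst, e1, e2, e3, if_neg hp', if_neg hp, hsw, hcast]
        push_cast
        linarith
    · obtain ⟨f1, f2, f3, -⟩ := hx.endIteration_cases (ε := ε)
        ((x.1.acc + payoff P r (t₀ + x.1.elapsed) x) / len)
      refine le_trans ?_ (le_blockValue_succ (a := K + (guarantee P r j ε μ v m len b t₀ x -
        payoff P r (t₀ + x.1.elapsed) x)) fun z => le_trans ?_ (hmain z))
      · linarith
      · have hfst : (advance P r ε m len b (t₀ + x.1.elapsed) x z).1 = { x.1.endIteration ε m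
            ((x.1.acc + payoff P r (t₀ + x.1.elapsed) x) / len) with elapsed := x.1.elapsed + 1 } := e
        have htr : Tracking P r j (t₀ + x.1.elapsed) x →
            Tracking P r j (t₀ + (x.1.elapsed + 1)) (advance P r ε m len b (t₀ + x.1.elapsed) x z) := by
          intro h
          refine ⟨h.advance_snd hp z, t₀ + (x.1.elapsed + 1), ?_, ?_⟩
          · rw [hfst]; simp [f1]
          · rw [hfst]; simp [f1, f2]
        have h1 := risk_mono (ρ := 1 - prob k S) (μ := μ) (ε := ε) (m := m)
          (c := (advance P r ε m len b (t₀ + x.1.elapsed) x z).1) hρ0 htr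
        have h3 := risk_endIteration (ρ := 1 - prob k S) (μ := μ) (ε := ε) (m := m) (c := x.1)
          (tr := Tracking P r j (t₀ + x.1.elapsed) x)
          (a := (x.1.acc + payoff P r (t₀ + x.1.elapsed) x) / len)
          (c' := (advance P r ε m len b (t₀ + x.1.elapsed) x z).1) hρ0 hρ1 hp hx.length_le hx.fails_lt
          hx.phase_one (fun h => h.abs_average_sub_le hx hp hc (by omega) hM hgood)
          (by rw [hfst]) (by rw [hfst]) (by rw [hfst]) (by rw [hfst])
        have h2 := mul_le_mul_of_nonneg_left (h1.trans h3) hbv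
        have hlen : (x.1.count : ℝ) + 1 = len := by exact_mod_cast hc
        have hlen0 : (0 : ℝ) < len := by rw [← hlen]; positivity
        have hacc := hx.acc_nonneg
        have hcount : (advance P r ε m len b (t₀ + x.1.elapsed) x z).1.count = 0 := by rw [hfst]; exact f1
        have hacc' : (advance P r ε m len b (t₀ + x.1.elapsed) x z).1.acc = 0 := by rw [hfst]; exact f2
        have hel : (advance P r ε m len b (t₀ + x.1.elapsed) x z).1.elapsed = x.1.elapsed + 1 := e1
        have hpe : (advance P r ε m len b (t₀ + x.1.elapsed) x z).1.pending ↔ (x.1.endIteration ε m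
            ((x.1.acc + payoff P r (t₀ + x.1.elapsed) x) / len)).pending := by rw [hfst]
        have hsw : (advance P r ε m len b (t₀ + x.1.elapsed) x z).1.switches m = (x.1.endIteration ε m
            ((x.1.acc + payoff P r (t₀ + x.1.elapsed) x) / len)).switches m := by rw [hfst]; rfl
        rw [guarantee, guarantee, hel, hcount, hacc', if_neg hp, hsw, hcast]
        -- If a switch follows, the released `len + 1` pays for the iteration, worth at most `len`,
        -- and for the switch round. If not, phase I is over and the iteration has earned its worth
        -- `v * len` itself.
        rcases f3 with ⟨g1, g2⟩ | ⟨g1, g2, g3, g4⟩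
        · rw [if_pos (hpe.2 g1), g2]
          have hvc : v * x.1.count = v * len - v := by rw [← hlen]; ring
          have hvl : v * len ≤ len := mul_le_of_le_one_left hlen0.le hv1
          push_cast
          linarith
        · rw [if_neg (fun h => g1 (hpe.1 h)), g2]
          have havg := le_of_not_tooLow hrisk g3 g4
          rw [le_div_iff₀ hlen0] at havg
          have : v * len ≤ x.1.acc + payoff P r (t₀ + x.1.elapsed) x := by
            rcases hv with hv | hv
            · rw [hv]; linarith
            · exact (mul_le_mul_of_nonneg_right hv hlen0.le).trans havg
          have hvc : v * x.1.count = v * len - v := by rw [← hlen]; ring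
          push_cast
          linarith

end

/-! ### The energy of a sequence at a given scale -/

/-- The sum of the squares of the averages over the first `N` blocks of length `c`, weighted by the length. -/
def energy (f : ℕ → ℝ) (c N : ℕ) : ℝ :=
  ∑ i ∈ Finset.range N, (∑ u ∈ Finset.range c, f (i * c + u)) ^ 2 / c

section

variable {f : ℕ → ℝ}

lemma energy_mono {c N N' : ℕ} (h : N ≤ N') : energy f c N ≤ energy f c N' :=
  Finset.sum_le_sum_of_subset_of_nonneg (Finset.range_mono h) fun _ _ _ => by positivity

lemma energy_nonneg (c N : ℕ) : 0 ≤ energy f c N := Finset.sum_nonneg fun _ _ => by positivity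

lemma energy_one_le (h0 : ∀ t, 0 ≤ f t) (h1 : ∀ t, f t ≤ 1) (T : ℕ) : energy f 1 T ≤ T := by
  unfold energy
  calc _ ≤ ∑ i ∈ Finset.range T, (1 : ℝ) := Finset.sum_le_sum fun i _ => by
        have := h0 i
        have := h1 i
        simp only [Finset.sum_range_one, mul_one, add_zero, Nat.cast_one, div_one]
        nlinarith
    _ = T := by simp

lemma sum_range_mul (g : ℕ → ℝ) (N d : ℕ) :
    ∑ t ∈ Finset.range (N * d), g t = ∑ i ∈ Finset.range N, ∑ q ∈ Finset.range d, g (i * d + q) := by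
  induction N with
  | zero => simp
  | succ N ih => rw [Finset.sum_range_succ, ← ih, add_mul, one_mul, Finset.sum_range_add]

/-- The variances of the averages inside the blocks are differences of energies. -/
lemma sum_variance_eq {d len : ℕ} (hd : 0 < d) (hlen : 0 < len) (N : ℕ) :
    ∑ i ∈ Finset.range N, (len : ℝ) * ∑ q ∈ Finset.range d,
      ((∑ u ∈ Finset.range len, f (i * (d * len) + q * len + u)) / len -
        (∑ u ∈ Finset.range (d * len), f (i * (d * len) + u)) / ((d * len : ℕ) : ℝ)) ^ 2 =
    energy f len (N * d) - energy f (d * len) N := by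
  have hd' : (d : ℝ) ≠ 0 := by positivity
  have hlen' : (len : ℝ) ≠ 0 := by positivity
  unfold energy
  rw [sum_range_mul, ← Finset.sum_sub_distrib]
  refine Finset.sum_congr rfl fun i _ => ?_
  have e : ∀ q u, (i * d + q) * len + u = i * (d * len) + q * len + u := fun q u => by ring
  have hs : ∑ u ∈ Finset.range (d * len), f (i * (d * len) + u) =
      ∑ q ∈ Finset.range d, ∑ u ∈ Finset.range len, f (i * (d * len) + q * len + u) := by
    rw [sum_range_mul]
    simp only [add_assoc]
  simp only [e]
  rw [hs]
  have : ∀ s : ℕ → ℝ, (len : ℝ) * ∑ q ∈ Finset.range d,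
      (s q / len - (∑ q ∈ Finset.range d, s q) / ((d * len : ℕ) : ℝ)) ^ 2 =
      ∑ q ∈ Finset.range d, s q ^ 2 / len - (∑ q ∈ Finset.range d, s q) ^ 2 / ((d * len : ℕ) : ℝ) := by
    intro s
    set A := ∑ q ∈ Finset.range d, s q with hA
    have h1 : ∀ q, (s q / len - A / ((d * len : ℕ) : ℝ)) ^ 2 =
        s q ^ 2 / len ^ 2 - 2 * A / (d * len ^ 2) * s q + A ^ 2 / (d * len) ^ 2 := by
      intro q
      push_cast
      field_simp
      ring
    simp only [h1, Finset.sum_add_distrib, Finset.sum_sub_distrib, ← Finset.mul_sum, ← Finset.sum_div, ← hA,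
      Finset.sum_const, Finset.card_range, nsmul_eq_mul]
    push_cast
    field_simp
    ring
  exact this fun q => ∑ u ∈ Finset.range len, f (i * (d * len) + q * len + u)

/-- The difference is a sum of variances; rounding `T` down to whole blocks of the longer length
only drops nonnegative terms at the shorter one. -/
lemma energy_succ_le {d len : ℕ} (hd : 0 < d) (hlen : 0 < len) (T : ℕ) :
    energy f (d * len) (T / (d * len)) ≤ energy f len (T / len) := by
  have h1 := sum_variance_eq (f := f) hd hlen (T / (d * len))
  have h2 : 0 ≤ ∑ i ∈ Finset.range (T / (d * len)), (len : ℝ) * ∑ q ∈ Finset.range d,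
      ((∑ u ∈ Finset.range len, f (i * (d * len) + q * len + u)) / len -
        (∑ u ∈ Finset.range (d * len), f (i * (d * len) + u)) / ((d * len : ℕ) : ℝ)) ^ 2 :=
    Finset.sum_nonneg fun _ _ => mul_nonneg (by positivity) (Finset.sum_nonneg fun _ _ => sq_nonneg _)
  have h3 : T / (d * len) * d ≤ T / len := by
    rw [mul_comm d len, ← Nat.div_div_eq_div_mul]
    exact Nat.div_mul_le_self _ _
  linarith [energy_mono (f := f) (c := len) h3]

end

/-! ### The expected reward at one scale -/

section

variable {n k S : ℕ} {P : Fin k → StatefulPolicy n S} {r : ℕ → Fin n → unitInterval}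
  {j : Fin k} {ε : ℝ} {m len d : ℕ}

/-- Lower bounds for the rewards in the blocks add up. -/
lemma sum_le_blockValue {b : ℕ} {g : ℕ → ℝ}
    (hg : ∀ (s N : ℕ) (K : ℝ), (∀ z, K ≤ blockValue P r ε m len b N (s * b + b) (Ctrl.start, z)) →
      ∀ z, K + g s ≤ blockValue P r ε m len b (N + b) (s * b) (Ctrl.start, z)) (R N s : ℕ) (z : Fin k × Fin S) :
    ∑ i ∈ Finset.range N, g (s + i) ≤ blockValue P r ε m len b (R + N * b) (s * b) (Ctrl.start, z) := by
  induction N generalizing s z with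
  | zero => simpa using blockValue_nonneg _ _ _
  | succ N ih =>
    rw [Finset.sum_range_succ', add_mul, one_mul, ← add_assoc]
    refine hg s _ _ (fun z => ?_) z
    have := ih (s + 1) z
    rw [add_mul, one_mul] at this
    refine le_trans (le_of_eq ?_) this
    exact Finset.sum_congr rfl fun i _ => by congr 1; omega

variable [NeZero k] [NeZero S]

lemma prob_pos : 0 < prob k S := by
  have hS : (1 : ℝ) ≤ S := by exact_mod_cast NeZero.one_le
  have hk : (1 : ℝ) ≤ k := by exact_mod_cast NeZero.one_le
  unfold prob
  positivity

lemma prob_le_one : prob k S ≤ 1 := by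
  have hS : (1 : ℝ) ≤ S := by exact_mod_cast NeZero.one_le
  have hk : (1 : ℝ) ≤ k := by exact_mod_cast NeZero.one_le
  unfold prob
  rw [div_le_one (by positivity)]
  nlinarith

/-- The expected reward from the beginning of a block on, in terms of the variance in the block. -/
lemma block_lower_bound {t₀ N : ℕ} {K : ℝ} (hε : 0 < ε) (hm : 0 < m) (hd : 0 < d) (hlen : 0 < len)
    (hM : ((m + m * m : ℕ) : ℝ) ≤ ε / 2 * len)
    (hK : ∀ z, K ≤ blockValue P r ε m len (d * len) N (t₀ + d * len) (Ctrl.start, z)) (z : Fin k × Fin S) :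
    K + (∑ u ∈ Finset.range (d * len), reference P r j (t₀ + u)
      - 4 * d / ε ^ 2 * (len * ∑ q ∈ Finset.range d,
        ((∑ u ∈ Finset.range len, reference P r j (t₀ + q * len + u)) / len -
          (∑ u ∈ Finset.range (d * len), reference P r j (t₀ + u)) / ((d * len : ℕ) : ℝ)) ^ 2)
      - (3 * ε * (d * len) + (len + 1) * ((m + m * m : ℕ) + 1) + 2 * (d * len) * (1 - prob k S) ^ (m - 1))) ≤
      blockValue P r ε m len (d * len) (N + d * len) t₀ (Ctrl.start, z) := by
  have hρ0 : 0 ≤ 1 - prob k S := by linarith [prob_le_one (k := k) (S := S)]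
  have hb : 0 < d * len := Nat.mul_pos hd hlen
  have hbR : (0 : ℝ) < (d * len : ℕ) := by exact_mod_cast hb
  have hcast : ((d * len : ℕ) : ℝ) = d * len := by push_cast; ring
  obtain ⟨i, hi⟩ : ∃ i, d * len = i + 1 := ⟨d * len - 1, by omega⟩
  have hsum0 : 0 ≤ ∑ u ∈ Finset.range (d * len), reference P r j (t₀ + u) :=
    Finset.sum_nonneg fun _ _ => reference_nonneg P r j _
  have hsum1 : ∑ u ∈ Finset.range (d * len), reference P r j (t₀ + u) ≤ (d * len : ℕ) := by
    calc _ ≤ ∑ u ∈ Finset.range (d * len), (1 : ℝ) := Finset.sum_le_sum fun u _ => reference_le_one P r j _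
      _ = _ := by simp
  set A := ∑ u ∈ Finset.range (d * len), reference P r j (t₀ + u) with hA
  set μ := A / ((d * len : ℕ) : ℝ) with hμ
  have hμA : μ * (d * len : ℕ) = A := by rw [hμ]; field_simp
  set W := (len : ℝ) * ∑ q ∈ Finset.range d,
        ((∑ u ∈ Finset.range len, reference P r j (t₀ + q * len + u)) / len - μ) ^ 2 with hW
  have hW0 : 0 ≤ 4 * d / ε ^ 2 * W :=
    mul_nonneg (by positivity) (mul_nonneg (by positivity) (Finset.sum_nonneg fun _ _ => sq_nonneg _))
  have hl0 : 0 ≤ ((len : ℝ) + 1) * ((m + m * m : ℕ) + 1) := by positivity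
  have hl1 : 0 ≤ 2 * ((d : ℝ) * len) * (1 - prob k S) ^ (m - 1) := by positivity
  have hl2 : 0 ≤ 3 * ε * ((d : ℝ) * len) := by positivity
  by_cases hgood : ∀ q < d, |(∑ u ∈ Finset.range len, reference P r j (t₀ + q * len + u)) / len - μ| ≤ ε / 2
  · have hμ1 : μ ≤ 1 := by rw [hμ, div_le_one hbR]; exact hsum1
    have := add_guarantee_le_blockValue (v := max 0 (μ - 3 * ε)) (K := K) (N := N) (P := P) (r := r) (j := j)
      (t₀ := t₀) (μ := μ) rfl (le_max_left _ _) (max_le (by norm_num) (by linarith))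
      (by rcases max_choice 0 (μ - 3 * ε) with h | h
          · exact Or.inl h
          · exact Or.inr h.le) hM hgood hK i (Ctrl.start, z) (Ctrl.valid_start hm hlen)
      (by rw [hi]; simp [Ctrl.start])
    have hel : (Ctrl.start, z).1.elapsed = 0 := rfl
    rw [← hi] at this
    refine le_trans ?_ this
    have hr := risk_start (μ := μ) (ε := ε) (m := m)
      (tr := Tracking P r j (t₀ + (Ctrl.start, z).1.elapsed) (Ctrl.start, z)) hρ0 hm
    have hr' := mul_le_mul_of_nonneg_left hr hbR.le
    have hv := mul_le_mul_of_nonneg_right (le_max_right 0 (μ - 3 * ε)) hbR.le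
    have hpend : ¬ (Ctrl.start, z).1.pending := id
    rw [guarantee, if_neg hpend]
    simp only [Ctrl.start, Ctrl.switches, List.length_nil, zero_mul, add_zero, Nat.cast_zero, mul_zero, sub_zero] at *
    rw [hcast] at *
    linarith
  · push Not at hgood
    obtain ⟨q, hq, hbad⟩ := hgood
    have hsq : (ε / 2) ^ 2 ≤ ∑ q ∈ Finset.range d,
        ((∑ u ∈ Finset.range len, reference P r j (t₀ + q * len + u)) / len - μ) ^ 2 := by
      refine le_trans ?_ (Finset.single_le_sum (f := fun q =>
        ((∑ u ∈ Finset.range len, reference P r j (t₀ + q * len + u)) / len - μ) ^ 2)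
        (fun _ _ => sq_nonneg _) (Finset.mem_range.2 hq))
      rw [← sq_abs ((∑ u ∈ Finset.range len, reference P r j (t₀ + q * len + u)) / len - μ)]
      exact pow_le_pow_left₀ (by positivity) hbad.le 2
    -- One window deviating by more than `ε / 2` gives `W ≥ len * (ε / 2) ^ 2`; the factor `4d / ε²`
    -- scales this to the length of the block, so the claimed gain is nonpositive.
    have hW1 : (d : ℝ) * len ≤ 4 * d / ε ^ 2 * W := by
      calc (d : ℝ) * len = 4 * d / ε ^ 2 * (len * (ε / 2) ^ 2) := by field_simp; ring
        _ ≤ _ := mul_le_mul_of_nonneg_left (mul_le_mul_of_nonneg_left hsq (by positivity)) (by positivity)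
    have hlow := le_blockValue_of_le_start (t₀ := t₀) hK i (Ctrl.start, z) (by rw [hi]; simp [Ctrl.start])
    rw [← hi] at hlow
    refine le_trans ?_ hlow
    rw [hcast] at hsum1
    linarith

/-- The expected reward at one scale. -/
theorem scale_lower_bound {T : ℕ} (hε : 0 < ε) (hm : 0 < m) (hd : 0 < d) (hlen : 0 < len)
    (hM : ((m + m * m : ℕ) : ℝ) ≤ ε / 2 * len) (z : Fin k × Fin S) :
    ∑ t ∈ Finset.range T, reference P r j t - d * len
      - 4 * d / ε ^ 2 * (energy (reference P r j) len (T / len) -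
          energy (reference P r j) (d * len) (T / (d * len)))
      - T * (3 * ε + 2 * ((m + m * m : ℕ) + 1) / d + 2 * (1 - prob k S) ^ (m - 1)) ≤
      blockValue P r ε m len (d * len) T 0 (Ctrl.start, z) := by
  have hρ0 : 0 ≤ 1 - prob k S := by linarith [prob_le_one (k := k) (S := S)]
  set N := T / (d * len) with hN
  have hb : 0 < d * len := Nat.mul_pos hd hlen
  have hT : T % (d * len) + N * (d * len) = T := by rw [hN]; exact Nat.mod_add_div' _ _
  have hmod : T % (d * len) < d * len := Nat.mod_lt _ hb
  have key := sum_le_blockValue (P := P) (r := r) (ε := ε) (m := m) (len := len) (b := d * len)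
    (fun s N K hK z => block_lower_bound (j := j) (t₀ := s * (d * len)) hε hm hd hlen hM hK z)
    (T % (d * len)) N 0 z
  rw [hT, zero_mul] at key
  refine le_trans ?_ key
  simp only [zero_add]
  rw [Finset.sum_sub_distrib, Finset.sum_sub_distrib, ← Finset.mul_sum, sum_variance_eq hd hlen,
    ← sum_range_mul (fun t => reference P r j t)]
  simp only [Finset.sum_const, Finset.card_range, nsmul_eq_mul]
  -- The truncated last block is given up.
  have h1 : ∑ t ∈ Finset.range T, reference P r j t ≤
      ∑ t ∈ Finset.range (N * (d * len)), reference P r j t + d * len := by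
    rw [← hT, add_comm, Finset.sum_range_add]
    have : ∑ u ∈ Finset.range (T % (d * len)), reference P r j (N * (d * len) + u) ≤
        ∑ u ∈ Finset.range (T % (d * len)), (1 : ℝ) :=
      Finset.sum_le_sum fun u _ => reference_le_one P r j _
    simp only [Finset.sum_const, Finset.card_range, nsmul_eq_mul, mul_one] at this
    have h2 : ((T % (d * len) : ℕ) : ℝ) ≤ d * len := by exact_mod_cast hmod.le
    linarith
  have h2 : energy (reference P r j) len (N * d) ≤ energy (reference P r j) len (T / len) := by
    apply energy_mono
    rw [hN, mul_comm d len, ← Nat.div_div_eq_div_mul]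
    exact Nat.div_mul_le_self _ _
  have h3 := mul_le_mul_of_nonneg_left (sub_le_sub_right h2 (energy (reference P r j) (d * len) N))
    (show 0 ≤ 4 * (d : ℝ) / ε ^ 2 by positivity)
  have hd' : (0 : ℝ) < d := by exact_mod_cast hd
  have hlen' : (1 : ℝ) ≤ len := by exact_mod_cast hlen
  have h4 : (N : ℝ) * (3 * ε * (d * len) + (len + 1) * ((m + m * m : ℕ) + 1) +
      2 * (d * len) * (1 - prob k S) ^ (m - 1)) ≤
      T * (3 * ε + 2 * ((m + m * m : ℕ) + 1) / d + 2 * (1 - prob k S) ^ (m - 1)) := by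
    have hNT : (N : ℝ) * (d * len) ≤ T := by exact_mod_cast (show N * (d * len) ≤ T by omega)
    refine le_trans ?_ (mul_le_mul_of_nonneg_right hNT (by positivity))
    rw [mul_assoc (N : ℝ)]
    refine mul_le_mul_of_nonneg_left ?_ (by positivity)
    have : (d * len : ℝ) * (2 * ((m + m * m : ℕ) + 1) / d) = (2 * len) * ((m + m * m : ℕ) + 1) := by
      field_simp
    have h5 : ((len : ℝ) + 1) * ((m + m * m : ℕ) + 1) ≤ (2 * len) * ((m + m * m : ℕ) + 1) :=
      mul_le_mul_of_nonneg_right (by linarith) (by positivity)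
    linarith
  linarith

end

/-! ### The regret in terms of the parameters -/

section

variable {n k S : ℕ} {P : Fin k → StatefulPolicy n S} {r : ℕ → Fin n → unitInterval} {T : ℕ}

lemma sum_reference_le (j : Fin k) : ∑ t ∈ Finset.range T, reference P r j t ≤ T := by
  calc _ ≤ ∑ t ∈ Finset.range T, (1 : ℝ) := Finset.sum_le_sum fun t _ => reference_le_one P r j t
    _ = T := by simp

lemma sum_pow_succ_le {d : ℕ} (hd : 2 ≤ d) (L : ℕ) : ∑ i ∈ Finset.range L, (d : ℝ) ^ (i + 1) ≤ 2 * d ^ L := by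
  induction L with
  | zero => simp
  | succ L ih =>
    have : (2 : ℝ) ≤ d := by exact_mod_cast hd
    have h0 : (0 : ℝ) < d ^ L := by positivity
    rw [Finset.sum_range_succ, pow_succ]
    nlinarith

variable [NeZero k] [NeZero S]

lemma regret_le_of_forall {B : ℝ}
    (h : ∀ j, ∑ t ∈ Finset.range T, reference P r j t ≤ (algorithm P T).expectedReward r T + B) :
    (algorithm P T).regret P r T ≤ B := by
  rw [Player.regret, sub_le_iff_le_add']
  exact ciSup_le h

lemma regret_le_rounds : (algorithm P T).regret P r T ≤ T := by
  refine regret_le_of_forall fun j => ?_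
  have := le_expectedReward_algorithm P r T (fun _ => 0) fun i _ z => blockValue_nonneg _ _ _
  simp only [Finset.sum_const_zero, zero_div] at this
  linarith [sum_reference_le (P := P) (r := r) (T := T) j]

/-- Averaging over the scales makes the energy drops telescope to at most `T`, and the truncated
blocks sum geometrically to at most `2 * d ^ L ≤ 2T`. The two smallest scales are given up, at a
cost of `T` each, because `hM` bounds the switches only when `len ≥ d ^ 2`. Hence `4 + 4d / ε²`. -/
theorem regret_le_of_parameters {ε : ℝ} {d L m : ℕ} (hε' : eps (prob k S) T = ε) (hd' : base (prob k S) ε = d)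
    (hL' : numScales d T = L) (hm' : reps (prob k S) ε = m) (hε : 0 < ε) (hm : 0 < m) (hd : 2 ≤ d)
    (hdL : d ^ L ≤ T) (hM : ((m + m * m : ℕ) : ℝ) ≤ ε / 2 * d ^ 2) :
    (algorithm P T).regret P r T ≤ T * ((4 + 4 * d / ε ^ 2) / L +
      (3 * ε + 2 * ((m + m * m : ℕ) + 1) / d + 2 * (1 - prob k S) ^ (m - 1))) := by
  have hρ0 : 0 ≤ 1 - prob k S := by linarith [prob_le_one (k := k) (S := S)]
  have hLpos : (0 : ℝ) < L := by
    rw [← hL']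
    exact_mod_cast Nat.pos_of_ne_zero (NeZero.ne _)
  refine regret_le_of_forall fun j => ?_
  set D := ∑ t ∈ Finset.range T, reference P r j t with hD
  set lam := 3 * ε + 2 * (((m + m * m : ℕ) : ℝ) + 1) / d + 2 * (1 - prob k S) ^ (m - 1) with hlam
  set e : ℕ → ℝ := fun i => energy (reference P r j) (d ^ i) (T / d ^ i) with he
  have hdpos : 0 < d := by omega
  have hanti : ∀ i, e (i + 1) ≤ e i := by
    intro i
    simp only [he, pow_succ']
    exact energy_succ_le hdpos (by positivity) T
  have hdε : 0 ≤ 4 * (d : ℝ) / ε ^ 2 := by positivity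
  have hlam0 : 0 ≤ lam := by positivity
  have hdecr : ∀ i, 0 ≤ 4 * d / ε ^ 2 * (e i - e (i + 1)) :=
    fun i => mul_nonneg hdε (by linarith [hanti i])
  set g : ℕ → ℝ := fun i => D - d ^ (i + 1) - 4 * d / ε ^ 2 * (e i - e (i + 1)) - T * lam -
    (if i < 2 then (T : ℝ) else 0) with hg
  have key := le_expectedReward_algorithm P r T g (by
    rw [hε', hd', hL', hm']
    intro i _ z
    simp only [hg]
    split_ifs with hi2
    · refine le_trans ?_ (blockValue_nonneg _ _ _)
      have h1 := hdecr i
      have h2 : D ≤ T := sum_reference_le j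
      have h3 : 0 ≤ (d : ℝ) ^ (i + 1) := by positivity
      have h4 : 0 ≤ T * lam := by positivity
      linarith
    · have hlen : d ^ (i + 1) / d = d ^ i := by
        rw [pow_succ, Nat.mul_div_cancel _ hdpos]
      have hge : (d : ℝ) ^ 2 ≤ (d ^ i : ℕ) := by
        exact_mod_cast Nat.pow_le_pow_right hdpos (by omega)
      have := scale_lower_bound (P := P) (r := r) (j := j) (len := d ^ i) (T := T) hε hm hdpos
        (by positivity) (hM.trans (mul_le_mul_of_nonneg_left hge (by positivity))) z
      have hc : (d : ℝ) * ((d ^ i : ℕ) : ℝ) = d ^ (i + 1) := by push_cast; rw [pow_succ']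
      rw [hc, ← pow_succ'] at this
      rw [hlen]
      linarith)
  rw [hε', hd', hL'] at key
  have hsum : L * D - (2 * T + 4 * d / ε ^ 2 * T + L * (T * lam) + 2 * T) ≤ ∑ i ∈ Finset.range L, g i := by
    simp only [hg, Finset.sum_sub_distrib, ← Finset.mul_sum, Finset.sum_const, Finset.card_range, nsmul_eq_mul]
    rw [← Finset.sum_sub_distrib, Finset.sum_range_sub']
    have h1 := sum_pow_succ_le hd L
    have h2 : (d : ℝ) ^ L ≤ T := by exact_mod_cast hdL
    have h3 : e 0 - e L ≤ T := by
      have h4 : e 0 ≤ T := by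
        simp only [he, pow_zero, Nat.div_one]
        exact energy_one_le (reference_nonneg P r j) (reference_le_one P r j) T
      have h5 : 0 ≤ e L := energy_nonneg _ _
      linarith
    have h6 := mul_le_mul_of_nonneg_left h3 hdε
    have h7 : ∑ i ∈ Finset.range L, (if i < 2 then (T : ℝ) else 0) ≤ 2 * T := by
      rw [← Finset.sum_filter, Finset.sum_const, nsmul_eq_mul]
      refine mul_le_mul_of_nonneg_right ?_ (by positivity)
      have : ((Finset.range L).filter (· < 2)).card ≤ (Finset.range 2).card :=
        Finset.card_le_card fun i hi => Finset.mem_range.2 (Finset.mem_filter.1 hi).2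
      rw [Finset.card_range] at this
      exact_mod_cast this
    linarith
  have hdiv := (div_le_div_of_nonneg_right hsum hLpos.le).trans key
  have heq : (L * D - (2 * T + 4 * d / ε ^ 2 * T + L * (T * lam) + 2 * T)) / L =
      D - T * ((4 + 4 * d / ε ^ 2) / L + lam) := by
    field_simp
    ring
  rw [heq] at hdiv
  linarith

end

/-! ### The choice of the parameters -/

section

variable {p ε : ℝ} {T : ℕ}

lemma eps_pos (hp : 0 < p) (hT : 3 ≤ T) : 0 < eps p T := by
  have hT' : (3 : ℝ) ≤ T := by exact_mod_cast hT
  have h1 : 1 < Real.log T := by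
    rw [Real.lt_log_iff_exp_lt (by linarith)]
    linarith [Real.exp_one_lt_d9]
  have h2 : 0 < Real.log (Real.log T) := Real.log_pos h1
  unfold eps
  positivity

/-- The definition of `ε` freed of roots, for comparing its powers with `log T`. -/
lemma eps_pow_four (hp : 0 < p) (hT : 3 ≤ T) :
    eps p T ^ 4 * p ^ 2 * Real.log T = Real.log (Real.log T) ^ 4 := by
  have h0 : 0 < Real.log T := Real.log_pos (by exact_mod_cast (show 1 < T by omega))
  have h1 : (Real.log T ^ (1 / 4 : ℝ)) ^ 4 = Real.log T := by
    rw [← Real.rpow_natCast, ← Real.rpow_mul h0.le]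
    norm_num
  have h2 : √p ^ 4 = p ^ 2 := by
    rw [show (4 : ℕ) = 2 * 2 by norm_num, pow_mul, Real.sq_sqrt hp.le]
  rw [eps, mul_pow, div_pow, div_pow, h1, h2]
  field_simp

/-- If `ε` is small, then `T` is large. -/
lemma one_le_log_log (hp : 0 < p) (hp1 : p ≤ 1) (hT : 3 ≤ T) (hε : eps p T ≤ 1 / 100) :
    1 ≤ Real.log (Real.log T) := by
  have hT' : (3 : ℝ) ≤ T := by exact_mod_cast hT
  have h3 : (1.026 : ℝ) ≤ Real.log 3 := by
    have h : Real.log 3 = Real.log 2 + Real.log (3 / 2) := by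
      rw [← Real.log_mul (by norm_num) (by norm_num)]; norm_num
    have := Real.one_sub_inv_le_log_of_pos (show (0 : ℝ) < 3 / 2 by norm_num)
    have := Real.log_two_gt_d9
    norm_num at *
    linarith
  have hl : (1.026 : ℝ) ≤ Real.log T := h3.trans (Real.log_le_log (by norm_num) hT')
  set l := Real.log T with hldef
  set y := Real.log l with hy
  have hl0 : 0 < l := by linarith
  have hy0 : 0.025 ≤ y := by
    have h4 := Real.one_sub_inv_le_log_of_pos hl0
    have h5 : l⁻¹ ≤ (1.026 : ℝ)⁻¹ := inv_anti₀ (by norm_num) hl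
    norm_num at *
    linarith
  -- If `y < 1` then `l ≤ 3`, and the identity for `ε ^ 4` gives `y ^ 4 ≤ 3 * 10⁻⁸`, less than
  -- `0.025 ^ 4`.
  by_contra hcon
  have hy1 : y < 1 := not_le.1 hcon
  have hle : l ≤ Real.exp 1 := by
    rw [← Real.log_le_iff_le_exp hl0]; exact hy1.le
  have h4 := eps_pow_four hp hT
  rw [← hldef, ← hy] at h4
  have hε0 := eps_pos hp hT
  have h5 : eps p T ^ 4 ≤ (1 / 100) ^ 4 := pow_le_pow_left₀ hε0.le hε 4
  have h6 : p ^ 2 ≤ 1 := pow_le_one₀ hp.le hp1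
  have h7 : l ≤ 3 := hle.trans (by linarith [Real.exp_one_lt_d9])
  have h8 : eps p T ^ 4 * p ^ 2 * l ≤ (1 / 100) ^ 4 * 1 * 3 := by gcongr
  have h9 : (0.025 : ℝ) ^ 4 ≤ y ^ 4 := pow_le_pow_left₀ (by norm_num) hy0 4
  norm_num at h8 h9
  linarith

/-- Logarithms of `eps_pow_four`: both `log p ≤ 0` and `log log log T ≥ 0` have the favourable sign.
-/
lemma log_one_div_eps_le (hp : 0 < p) (hp1 : p ≤ 1) (hT : 3 ≤ T) (hy : 1 ≤ Real.log (Real.log T)) :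
    Real.log (1 / eps p T) ≤ Real.log (Real.log T) / 4 := by
  have h0 : 0 < Real.log T := Real.log_pos (by exact_mod_cast (show 1 < T by omega))
  have h4 := congrArg Real.log (eps_pow_four hp hT)
  have hε0 := eps_pos hp hT
  rw [Real.log_mul (by positivity) h0.ne', Real.log_mul (by positivity) (by positivity), Real.log_pow,
    Real.log_pow, Real.log_pow] at h4
  have h5 : 0 ≤ Real.log (Real.log (Real.log T)) := Real.log_nonneg hy
  have h6 : Real.log p ≤ 0 := Real.log_nonpos hp.le hp1
  rw [one_div, Real.log_inv]
  push_cast at h4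
  linarith

lemma reps_bounds (hp : 0 < p) (hp1 : p ≤ 1) (ha : 1 ≤ Real.log (1 / ε)) :
    Real.log (1 / ε) / p ≤ reps p ε ∧ (reps p ε : ℝ) ≤ 2 * Real.log (1 / ε) / p := by
  have h : 1 ≤ Real.log (1 / ε) / p := by
    rw [le_div_iff₀ hp]; linarith
  unfold reps
  rw [one_div_mul_eq_div]
  refine ⟨Nat.le_ceil _, ?_⟩
  have := (Nat.ceil_lt_add_one (show 0 ≤ Real.log (1 / ε) / p by linarith)).le
  rw [mul_div_assoc]
  linarith

/-- The unrounded value is at least `16`, so rounding up at most doubles it and the default value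
`2` plays no role. -/
lemma base_bounds (hp : 0 < p) (hp1 : p ≤ 1) (hε0 : 0 < ε) (hε : ε ≤ 1 / 100) (ha : 1 ≤ Real.log (1 / ε)) :
    Real.log (1 / ε) ^ 2 / (p ^ 2 * ε) ≤ base p ε ∧
      (base p ε : ℝ) ≤ 2 * Real.log (1 / ε) ^ 2 / (p ^ 2 * ε) ∧ (16 : ℝ) ≤ base p ε := by
  have h : 16 ≤ Real.log (1 / ε) ^ 2 / (p ^ 2 * ε) := by
    rw [le_div_iff₀ (by positivity)]
    have h1 : p ^ 2 ≤ 1 := pow_le_one₀ hp.le hp1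
    nlinarith
  have hc : Real.log (1 / ε) ^ 2 / (p ^ 2 * ε) ≤ ⌈Real.log (1 / ε) ^ 2 / (p ^ 2 * ε)⌉₊ := Nat.le_ceil _
  have hc' := (Nat.ceil_lt_add_one (show 0 ≤ Real.log (1 / ε) ^ 2 / (p ^ 2 * ε) by linarith)).le
  have hbase : base p ε = ⌈Real.log (1 / ε) ^ 2 / (p ^ 2 * ε)⌉₊ := by
    unfold base
    rw [one_div_mul_eq_div]
    apply max_eq_right
    have : (2 : ℝ) ≤ ⌈Real.log (1 / ε) ^ 2 / (p ^ 2 * ε)⌉₊ := by linarith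
    exact_mod_cast this
  rw [hbase, mul_div_assoc]
  exact ⟨hc, by linarith, by linarith⟩

/-- The number of switches in a block is small compared to the base. -/
lemma switches_le_base (hp : 0 < p) (hp1 : p ≤ 1) (hε0 : 0 < ε) (hε : ε ≤ 1 / 100) (ha : 1 ≤ Real.log (1 / ε)) :
    ((reps p ε + reps p ε * reps p ε : ℕ) : ℝ) ≤ 8 * ε * base p ε := by
  obtain ⟨hm1, hm2⟩ := reps_bounds hp hp1 ha
  obtain ⟨hd1, -, -⟩ := base_bounds hp hp1 hε0 hε ha
  have hm0 : (1 : ℝ) ≤ reps p ε := by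
    refine le_trans ?_ hm1
    rw [le_div_iff₀ hp]; linarith
  generalize Real.log (1 / ε) = a at *
  generalize (base p ε : ℝ) = d at *
  have h1 : ((reps p ε + reps p ε * reps p ε : ℕ) : ℝ) ≤ 2 * (2 * a / p) ^ 2 := by
    push_cast
    have : (reps p ε : ℝ) ^ 2 ≤ (2 * a / p) ^ 2 := pow_le_pow_left₀ (by linarith) hm2 2
    nlinarith
  -- `m²` is of order `a² / p²`, which is `ε` times the unrounded `d`.
  have h2 : 8 * ε * (a ^ 2 / (p ^ 2 * ε)) ≤ 8 * ε * d := by gcongr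
  refine h1.trans (le_of_eq_of_le ?_ h2)
  field_simp
  ring

/-- The probability that all draws miss the reference policy is small. -/
lemma miss_le (hp : 0 < p) (hp1 : p ≤ 1) (hε0 : 0 < ε) (ha : 1 ≤ Real.log (1 / ε)) :
    (1 - p) ^ (reps p ε - 1) ≤ 3 * ε := by
  obtain ⟨hm1, -⟩ := reps_bounds hp hp1 ha
  rw [div_le_iff₀ hp] at hm1
  have hmpos : 1 ≤ reps p ε := by
    rw [Nat.one_le_iff_ne_zero]
    intro h
    rw [h, Nat.cast_zero, zero_mul] at hm1
    linarith
  have h1 : (1 - p) ^ (reps p ε - 1) ≤ Real.exp (-p) ^ (reps p ε - 1) :=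
    pow_le_pow_left₀ (by linarith) (Real.one_sub_le_exp_neg p) _
  -- The draw missing from the exponent costs a factor of at most `exp p ≤ e`.
  have h2 : Real.exp (-p) ^ (reps p ε - 1) ≤ Real.exp (1 - Real.log (1 / ε)) := by
    rw [← Real.exp_nat_mul, Real.exp_le_exp, Nat.cast_sub hmpos]
    push_cast
    linarith
  have h3 : Real.exp (1 - Real.log (1 / ε)) = Real.exp 1 * ε := by
    rw [Real.exp_sub, Real.exp_log (by positivity)]
    field_simp
  have h4 : Real.exp 1 * ε ≤ 3 * ε := mul_le_mul_of_nonneg_right (by linarith [Real.exp_one_lt_d9]) hε0.le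
  linarith

/-- `eps_pow_four` trades `1 / p²` for `ε⁴ log T / (log log T)⁴`, and `log (1 / ε) ≤ log log T / 4`
does the rest. The power `ε³` is what makes `d / ε²` at most `ε` times the number of scales. -/
lemma base_le (hp : 0 < p) (hp1 : p ≤ 1) (hT : 3 ≤ T) (hε : eps p T ≤ 1 / 100)
    (ha : 1 ≤ Real.log (1 / eps p T)) (hy : 1 ≤ Real.log (Real.log T)) :
    (base p (eps p T) : ℝ) ≤ eps p T ^ 3 * Real.log T / (8 * Real.log (Real.log T) ^ 2) := by
  have hε0 := eps_pos hp hT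
  obtain ⟨-, hd2, -⟩ := base_bounds hp hp1 hε0 hε ha
  have hay := log_one_div_eps_le hp hp1 hT hy
  have h4 := eps_pow_four hp hT
  have hl0 : 0 < Real.log T := Real.log_pos (by exact_mod_cast (show 1 < T by omega))
  refine hd2.trans ?_
  generalize Real.log (1 / eps p T) = a at *
  generalize Real.log (Real.log T) = y at *
  generalize Real.log T = l at *
  generalize eps p T = ε at *
  have hdiv : a ^ 2 / (p ^ 2 * ε) = a ^ 2 * ε ^ 3 * l / y ^ 4 := by
    rw [← h4]
    field_simp
  have ha2 : a ^ 2 ≤ y ^ 2 / 16 := by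
    rw [show y ^ 2 / 16 = (y / 4) ^ 2 by ring]
    exact pow_le_pow_left₀ (by linarith) hay 2
  rw [mul_div_assoc, hdiv]
  calc 2 * (a ^ 2 * ε ^ 3 * l / y ^ 4) ≤ 2 * (y ^ 2 / 16 * ε ^ 3 * l / y ^ 4) := by gcongr
    _ = _ := by field_simp; norm_num

/-- This gives `log d ≤ log log T`, so that there are at least `log T / (2 log log T)` scales. -/
lemma base_le_log (hp : 0 < p) (hp1 : p ≤ 1) (hT : 3 ≤ T) (hε : eps p T ≤ 1 / 100)
    (ha : 1 ≤ Real.log (1 / eps p T)) (hy : 1 ≤ Real.log (Real.log T)) :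
    (base p (eps p T) : ℝ) ≤ Real.log T := by
  have hε0 := eps_pos hp hT
  have hl0 : 0 < Real.log T := Real.log_pos (by exact_mod_cast (show 1 < T by omega))
  refine (base_le hp hp1 hT hε ha hy).trans ?_
  rw [div_le_iff₀ (by positivity)]
  have h1 : eps p T ^ 3 ≤ 1 := pow_le_one₀ hε0.le (by linarith)
  have h2 : 1 ≤ 8 * Real.log (Real.log T) ^ 2 := by nlinarith
  nlinarith

/-- A lower bound on the number of scales. -/
lemma log_le_mul_natLog {d : ℕ} {y : ℝ} (hd : 2 ≤ d) (hdT : d ≤ T) (hy : Real.log d ≤ y) :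
    Real.log T ≤ 2 * y * Nat.log d T := by
  have hL1 : (1 : ℝ) ≤ Nat.log d T := by exact_mod_cast Nat.log_pos (by omega) hdT
  have hTpos : (0 : ℝ) < T := by exact_mod_cast (show 0 < T by omega)
  have h1 : (T : ℝ) ≤ (d : ℝ) ^ (Nat.log d T + 1) := by
    exact_mod_cast (Nat.lt_pow_succ_log_self (show 1 < d by omega) T).le
  have h2 := Real.log_le_log hTpos h1
  rw [Real.log_pow] at h2
  push_cast at h2
  have h3 : 0 ≤ Real.log d := Real.log_nonneg (by exact_mod_cast (show 1 ≤ d by omega))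
  nlinarith

/-- The loss that is shared by the scales. -/
lemma scales_loss_le {y l d L : ℝ} (hp : 0 < p) (hp1 : p ≤ 1) (hε0 : 0 < ε) (hε1 : ε ≤ 1) (hy : 1 ≤ y) (hl : 0 < l)
    (hL : 1 ≤ L) (h4 : ε ^ 4 * p ^ 2 * l = y ^ 4) (hd : d ≤ ε ^ 3 * l / (8 * y ^ 2)) (hlL : l ≤ 2 * y * L) :
    (4 + 4 * d / ε ^ 2) / L ≤ 9 * ε := by
  rw [div_le_iff₀ (by linarith)]
  have h1 : y ≤ ε * l := by
    have h2 : y ≤ y ^ 4 := le_self_pow₀ hy (by norm_num)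
    have h3 : ε ^ 4 * p ^ 2 ≤ ε * 1 :=
      mul_le_mul (pow_le_of_le_one hε0.le hε1 (by norm_num)) (pow_le_one₀ hp.le hp1) (by positivity) hε0.le
    have h5 := mul_le_mul_of_nonneg_right h3 hl.le
    linarith
  have h2 : 1 ≤ 2 * ε * L := by
    have h3 : y * 1 ≤ y * (2 * ε * L) := by
      have := mul_le_mul_of_nonneg_left hlL hε0.le
      linarith
    exact le_of_mul_le_mul_left h3 (by linarith)
  have h3 : 4 * d / ε ^ 2 ≤ ε * L := by
    rw [div_le_iff₀ (by positivity)]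
    have h5 : ε ^ 3 * l / (8 * y ^ 2) ≤ ε ^ 3 * (2 * y * L) / (8 * y ^ 2) := by gcongr
    have h6 : ε ^ 3 * (2 * y * L) / (8 * y ^ 2) = ε ^ 3 * L / (4 * y) := by field_simp; norm_num
    have h7 : ε ^ 3 * L / (4 * y) ≤ ε ^ 3 * L / 4 :=
      div_le_div_of_nonneg_left (by positivity) (by norm_num) (by linarith)
    have h8 : ε * L * ε ^ 2 = ε ^ 3 * L := by ring
    linarith
  linarith

end

/-- For `ε > 1 / 100` the trivial bound `T` suffices, which fixes the constant `100`. Otherwise the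
losses are `9ε` for the choice of scale, `3ε` for the thresholds, `32ε` for the switches and `6ε`
for the risk. -/
theorem regret_le_eps {n k S : ℕ} [NeZero k] [NeZero S] {P : Fin k → StatefulPolicy n S}
    {r : ℕ → Fin n → unitInterval} {T : ℕ} (hT : 3 ≤ T) :
    (algorithm P T).regret P r T ≤ 100 * (eps (prob k S) T * T) := by
  have hp := prob_pos (k := k) (S := S)
  have hp1 := prob_le_one (k := k) (S := S)
  have hTR : (3 : ℝ) ≤ T := by exact_mod_cast hT
  have hε0 := eps_pos hp hT
  rcases lt_or_ge (1 / 100) (eps (prob k S) T) with hbig | hε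
  · refine regret_le_rounds.trans ?_
    nlinarith
  have hy := one_le_log_log hp hp1 hT hε
  have ha : 1 ≤ Real.log (1 / eps (prob k S) T) := by
    rw [Real.le_log_iff_exp_le (by positivity), le_div_iff₀ hε0]
    nlinarith [Real.exp_one_lt_d9]
  -- The value `16` turns the bound `8 * ε * d` on the switches into `ε / 2 * d ^ 2`.
  have hd16 := (base_bounds hp hp1 hε0 hε ha).2.2
  have hdl := base_le hp hp1 hT hε ha hy
  have hdl' := base_le_log hp hp1 hT hε ha hy
  have hM := switches_le_base hp hp1 hε0 hε ha
  have hmiss := miss_le hp hp1 hε0 ha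
  have h4 := eps_pow_four hp hT
  have hl0 : 0 < Real.log T := Real.log_pos (by linarith)
  have hmpos : 0 < reps (prob k S) (eps (prob k S) T) :=
    Nat.ceil_pos.2 (mul_pos (by positivity) (by linarith))
  generalize hεdef : eps (prob k S) T = ε at *
  generalize hd : base (prob k S) ε = d at *
  generalize hm : reps (prob k S) ε = m at *
  have hd0 : (0 : ℝ) < d := by linarith
  have hd2 : 2 ≤ d := by exact_mod_cast (show (2 : ℝ) ≤ d by linarith)
  have hdT : d ≤ T := by exact_mod_cast hdl'.trans (Real.log_le_self (by linarith))
  have hL1 : 1 ≤ Nat.log d T := Nat.log_pos (by omega) hdT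
  have hmain := regret_le_of_parameters (P := P) (r := r) (T := T) hεdef hd
    (show numScales d T = Nat.log d T from max_eq_right hL1) hm hε0 hmpos hd2 (Nat.pow_log_le_self d (by omega))
    (hM.trans (by
      have h1 := mul_le_mul_of_nonneg_left hd16 (show 0 ≤ ε / 2 * d by positivity)
      rw [pow_two]
      linarith))
  refine hmain.trans ?_
  have hscales := scales_loss_le (L := (Nat.log d T : ℝ)) hp hp1 hε0 (by linarith) hy hl0
    (by exact_mod_cast hL1) h4 hdl (log_le_mul_natLog hd2 hdT (Real.log_le_log hd0 hdl'))
  have hloss : 2 * (((m + m * m : ℕ) : ℝ) + 1) / d ≤ 32 * ε := by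
    rw [div_le_iff₀ hd0]
    have : (1 : ℝ) ≤ (m + m * m : ℕ) := by exact_mod_cast (show 1 ≤ m + m * m by omega)
    linarith
  have hT0 : (0 : ℝ) ≤ T := by positivity
  calc _ ≤ (T : ℝ) * (100 * ε) := mul_le_mul_of_nonneg_left (by linarith) hT0
    _ = _ := by ring

end StatefulBandit

end

theorem theorem1 :
    -- the regret bound, with an absolute constant
    (∃ C : ℝ, 0 < C ∧
      ∀ (k S n T : ℕ) [NeZero k] [NeZero S], 3 ≤ T →
        ∀ (P : Fin k → StatefulBandit.StatefulPolicy n S) (r : ℕ → Fin n → unitInterval),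
          (StatefulBandit.algorithm P T).regret P r T ≤
            C * (√((k : ℝ) * S) *
              (T * Real.log (Real.log T) / Real.log T ^ (1 / 4 : ℝ)))) ∧
    -- sublinearity in `T`, uniformly in the policies and the reward functions
    (∀ (k S : ℕ) [NeZero k] [NeZero S] (η : ℝ), 0 < η →
      ∃ T₀ : ℕ, ∀ (n T : ℕ), T₀ ≤ T →
        ∀ (P : Fin k → StatefulBandit.StatefulPolicy n S) (r : ℕ → Fin n → unitInterval),
          (StatefulBandit.algorithm P T).regret P r T ≤ η * T) := by
  have heps : ∀ k S T : ℕ, StatefulBandit.eps (StatefulBandit.prob k S) T =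
      √((k : ℝ) * S) * (Real.log (Real.log T) / Real.log T ^ (1 / 4 : ℝ)) := by
    intro k S T
    rw [StatefulBandit.eps, StatefulBandit.prob, one_div, one_div, Real.sqrt_inv, inv_inv]
  constructor
  · refine ⟨100, by norm_num, ?_⟩
    intro k S n T _ _ hT P r
    refine (StatefulBandit.regret_le_eps hT).trans (le_of_eq ?_)
    rw [heps]
    ring
  · intro k S _ _ η hη
    have hlim : Filter.Tendsto (fun T : ℕ => 100 * (√((k : ℝ) * S) *
        (Real.log (Real.log T) / Real.log T ^ (1 / 4 : ℝ)))) Filter.atTop (nhds 0) := by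
      have h := ((isLittleO_log_rpow_atTop (show (0 : ℝ) < 1 / 4 by norm_num)).tendsto_div_nhds_zero.comp
        (Real.tendsto_log_atTop.comp tendsto_natCast_atTop_atTop)).const_mul (√((k : ℝ) * S)) |>.const_mul 100
      simpa using h
    obtain ⟨T₀, hT₀⟩ := Filter.eventually_atTop.1 (hlim.eventually_lt_const hη)
    refine ⟨max 3 T₀, fun n T hT P r => ?_⟩
    have h1 := hT₀ T (le_trans (le_max_right _ _) hT)
    refine (StatefulBandit.regret_le_eps (le_trans (le_max_left _ _) hT)).trans ?_
    rw [← heps] at h1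
    rw [← mul_assoc]
    exact mul_le_mul_of_nonneg_right h1.le (by positivity)
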